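/- Let $\Lambda>0$ and let $(\widetilde M,\widetilde g_{ij},\widetilde K_{ij})$ be maximal vacuum initial data with cosmological constant $\Lambda$: $\widetilde M$ is a compact 3-manifold, $\widetilde g_{ij}$ is a smooth Riemannian metric and $\widetilde K_{ij}$ a smooth symmetric tensor with $\widetilde g^{ij}\widetilde K_{ij}=0$, $\widetilde R=\widetilde K_{ij}\widetilde K^{ij}+2\Lambda$ and $\widetilde\nabla_i\widetilde K^{ij}=0$, where $\widetilde\nabla$ and $\widetilde R$ are the covariant derivative and the scalar curvature of $\widetilde g_{ij}$. Put $\widetilde\Omega^2=\widetilde K_{ij}\widetilde K^{ij}$, let $\widetilde V$ be the volume of $(\widetilde M,\widetilde g_{ij})$, and let $\widetilde\varsigma$ be the lowest eigenvalue of the linearization at $\phi\equiv 1$ of the Lichnerowicz equation of the data, $$L_\phi\gamma=-\Bigl(\widetilde\Delta-\frac{\widetilde R}{8}\Bigr)\gamma-\frac{5\Lambda}{4}\phi^4\gamma+\frac{7\widetilde\Omega^2}{8\phi^8}\gamma ,\qquad \phi\equiv 1.$$ The data are called strictly unstable if $\widetilde\varsigma<0$. Then: 1. $\displaystyle\int_{\widetilde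 M}\widetilde\Omega^2\,d\widetilde v\ \ge\ (\Lambda+\widetilde\varsigma)\,\widetilde V$. 2. If $\widetilde\Omega^2\le\Lambda$ and $\widetilde\Omega^2\not\equiv\Lambda$ on $\widetilde M$, then the data are strictly unstable. 3. If $\widetilde\Omega\equiv 0$, then $\widetilde\varsigma=-\Lambda$; if $\widetilde\Omega^2\equiv\Lambda$, then $\widetilde\varsigma=0$. -/

import Mathlib

open MeasureTheory Filter Topology
open scoped Manifold ContDiff Matrix

noncomputable section

namespace MaximalData

/-- The model space of a 3-dimensional manifold. -/
abbrev E3 : Type := EuclideanSpace ℝ (Fin 3)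

/-- Smooth Riemannian metrics on a 3-manifold `M`. -/
abbrev Metric (M : Type*) [TopologicalSpace M] [ChartedSpace E3 M] [IsManifold (𝓡 3) ∞ M] :=
  Bundle.ContMDiffRiemannianMetric (𝓡 3) ∞ E3 (fun x : M => TangentSpace (𝓡 3) x)

/-- Fields of bilinear forms (covariant 2-tensors) on `M`, without regularity. -/
abbrev BilinField (M : Type*) [TopologicalSpace M] [ChartedSpace E3 M] :=
  ∀ x : M, TangentSpace (𝓡 3) x →L[ℝ] TangentSpace (𝓡 3) x →L[ℝ] ℝ

/-- The `i`-th partial derivative of a function on `ℝ³`. -/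
def pd (i : Fin 3) (f : E3 → ℝ) (y : E3) : ℝ := fderiv ℝ f y (EuclideanSpace.single i 1)

section Coordinates

variable {M : Type*} [TopologicalSpace M] [ChartedSpace E3 M]

/-- The coordinate vector `∂ᵢ` of the chart `c`, at the point with coordinates `y`. -/
def coordVec (c : OpenPartialHomeomorph M E3) (i : Fin 3) (y : E3) :
    TangentSpace (𝓡 3) (c.symm y) :=
  mfderiv (𝓡 3) (𝓡 3) c.symm y (EuclideanSpace.single i (1 : ℝ) : E3)

/-- The components `Tᵢⱼ` of a covariant 2-tensor in the chart `c`, at the coordinates `y`. -/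
def coeff (T : BilinField M) (c : OpenPartialHomeomorph M E3) (y : E3) :
    Matrix (Fin 3) (Fin 3) ℝ :=
  Matrix.of fun i j => T (c.symm y) (coordVec c i y) (coordVec c j y)

variable [IsManifold (𝓡 3) ∞ M] (g : Metric M) (c : OpenPartialHomeomorph M E3)

/-- The components `gᵢⱼ` of the metric. -/
def lowerG (y : E3) : Matrix (Fin 3) (Fin 3) ℝ := coeff g.inner c y

/-- The components `gⁱʲ` of the inverse metric. -/
def upperG (y : E3) : Matrix (Fin 3) (Fin 3) ℝ := (lowerG g c y)⁻¹

/-- The density `√(det gᵢⱼ)` of the Riemannian volume. -/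
def sqrtDet (y : E3) : ℝ := Real.sqrt (lowerG g c y).det

/-- The Christoffel symbols `Γᵏᵢⱼ = ½ gᵏˡ (∂ᵢ gⱼₗ + ∂ⱼ gᵢₗ - ∂ₗ gᵢⱼ)`. -/
def christoffel (k i j : Fin 3) (y : E3) : ℝ :=
  (1 / 2 : ℝ) * ∑ l, upperG g c y k l *
    (pd i (fun z => lowerG g c z j l) y + pd j (fun z => lowerG g c z i l) y
      - pd l (fun z => lowerG g c z i j) y)

/-- The Ricci tensor
`Rᵢⱼ = ∂ₖ Γᵏᵢⱼ - ∂ⱼ Γᵏₖᵢ + Γᵏₖₗ Γˡᵢⱼ - Γᵏⱼₗ Γˡₖᵢ` (positive on round spheres). -/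
def ricci (i j : Fin 3) (y : E3) : ℝ :=
  ∑ k, (pd k (christoffel g c k i j) y - pd j (christoffel g c k k i) y
    + ∑ l, (christoffel g c k k l y * christoffel g c l i j y
      - christoffel g c k j l y * christoffel g c l k i y))

/-- The components `Kⁱʲ = gⁱᵃ gʲᵇ Kₐᵦ` of a covariant 2-tensor with both indices raised. -/
def raised (K : BilinField M) (i j : Fin 3) (y : E3) : ℝ :=
  ∑ a, ∑ b, upperG g c y i a * upperG g c y j b * coeff K c y a b

/-- The components `∇ᵢ Kⁱʲ = ∂ᵢ Kⁱʲ + Γⁱᵢₗ Kˡʲ + Γʲᵢₗ Kⁱˡ` of the divergence of `K`. -/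
def divergence (K : BilinField M) (j : Fin 3) (y : E3) : ℝ :=
  ∑ i, (pd i (raised g c K i j) y
    + ∑ l, (christoffel g c i i l y * raised g c K l j y
      + christoffel g c j i l y * raised g c K i l y))

/-- The Laplace-Beltrami operator in the chart `c`:
`(√det g)⁻¹ ∂ᵢ (√det g · gⁱʲ ∂ⱼ u)`, for the function `u` on `M`. -/
def coordLaplacian (u : M → ℝ) (y : E3) : ℝ :=
  (sqrtDet g c y)⁻¹ * ∑ i, pd i
    (fun z => sqrtDet g c z * ∑ j, upperG g c z i j * pd j (fun w => u (c.symm w)) z) y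

/-- The Riemannian volume of the domain of the chart `c`: the image under `c⁻¹` of
`√(det g) dy` on the target of the chart, as a measure on `M`. -/
def chartMeasure [MeasurableSpace M] : Measure M :=
  ((volume.restrict c.target).withDensity
    (fun y => ENNReal.ofReal (sqrtDet g c y))).map c.symm

end Coordinates

section Global

variable {M : Type*} [TopologicalSpace M] [ChartedSpace E3 M] [IsManifold (𝓡 3) ∞ M]

/-- The Riemannian volume measure: the least measure on `M` which dominates the measures of all
the charts of the atlas. (The latter are the restrictions of one measure to the chart domains, by
the change of variables formula, and that measure is their supremum.) -/
def vol [MeasurableSpace M] (g : Metric M) : Measure M :=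
  ⨆ c ∈ atlas E3 M, chartMeasure g c

/-- The scalar curvature `gⁱʲ Rᵢⱼ`. The coordinate expressions of this and the following
quantities do not depend on the chart; each is evaluated in the preferred chart at the point. -/
def scalarCurvature (g : Metric M) (x : M) : ℝ :=
  ∑ i, ∑ j, upperG g (chartAt E3 x) (chartAt E3 x x) i j *
    ricci g (chartAt E3 x) i j (chartAt E3 x x)

/-- The Laplacian of a function on `M`. -/
def laplacian (g : Metric M) (u : M → ℝ) (x : M) : ℝ :=
  coordLaplacian g (chartAt E3 x) u (chartAt E3 x x)

/-- The squared length `|∇u|² = gⁱʲ ∂ᵢu ∂ⱼu` of the gradient. -/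
def gradSq (g : Metric M) (u : M → ℝ) (x : M) : ℝ :=
  ∑ i, ∑ j, upperG g (chartAt E3 x) (chartAt E3 x x) i j *
    pd i (fun w => u ((chartAt E3 x).symm w)) (chartAt E3 x x) *
    pd j (fun w => u ((chartAt E3 x).symm w)) (chartAt E3 x x)

/-- The trace `gⁱʲ Kᵢⱼ`. -/
def trace (g : Metric M) (K : BilinField M) (x : M) : ℝ :=
  ∑ i, ∑ j, upperG g (chartAt E3 x) (chartAt E3 x x) i j *
    coeff K (chartAt E3 x) (chartAt E3 x x) i j

/-- The function `Ω² = Kᵢⱼ Kⁱʲ`. -/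
def omegaSq (g : Metric M) (K : BilinField M) (x : M) : ℝ :=
  ∑ i, ∑ j, coeff K (chartAt E3 x) (chartAt E3 x x) i j *
    raised g (chartAt E3 x) K i j (chartAt E3 x x)

/-- The operator
`L_φ γ = -(Δ - R/8) γ - (5Λ/4) φ⁴ γ + (7Ω²/(8φ⁸)) γ`,
the linearization at `φ` of the Lichnerowicz equation. -/
def linearized (Λ : ℝ) (g : Metric M) (K : BilinField M) (φ γ : M → ℝ) (x : M) : ℝ :=
  -(laplacian g γ x - scalarCurvature g x / 8 * γ x) - 5 * Λ / 4 * φ x ^ 4 * γ x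
    + 7 * omegaSq g K x / (8 * φ x ^ 8) * γ x

/-- Smooth real functions on `M`. -/
def IsSmooth (u : M → ℝ) : Prop := ContMDiff (𝓡 3) 𝓘(ℝ, ℝ) ∞ u

/-- The Sobolev space `H¹`: the functions `u ∈ L²` which are the `L²` limit of smooth functions
whose gradients form a Cauchy sequence in `L²`. -/
def MemH1 [MeasurableSpace M] (g : Metric M) (u : M → ℝ) : Prop :=
  MemLp u 2 (vol g) ∧ ∃ v : ℕ → M → ℝ, (∀ n, IsSmooth (v n)) ∧
    Tendsto (fun n => eLpNorm (u - v n) 2 (vol g)) atTop (𝓝 0) ∧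
    Tendsto (fun p : ℕ × ℕ => ∫ x, gradSq g (v p.1 - v p.2) x ∂vol g) atTop (𝓝 0)

/-- `lam` is an eigenvalue of `L_φ`: there is a nonzero `u ∈ H¹` with `L_φ u = lam u` in the sense
of distributions (`L_φ` is formally self-adjoint). By elliptic regularity such `u` are smooth when
`φ` is smooth and positive. -/
def IsEigenvalue [MeasurableSpace M] (Λ : ℝ) (g : Metric M) (K : BilinField M) (φ : M → ℝ)
    (lam : ℝ) : Prop :=
  ∃ u : M → ℝ, MemH1 g u ∧ ¬ u =ᵐ[vol g] 0 ∧
    ∀ ψ : M → ℝ, IsSmooth ψ →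
      ∫ x, u x * linearized Λ g K φ ψ x ∂vol g = lam * ∫ x, u x * ψ x ∂vol g

/-- `s` is the lowest eigenvalue of `L_φ`. -/
def IsLowestEigenvalue [MeasurableSpace M] (Λ : ℝ) (g : Metric M) (K : BilinField M) (φ : M → ℝ)
    (s : ℝ) : Prop :=
  IsLeast {lam : ℝ | IsEigenvalue Λ g K φ lam} s

end Global

/-- Maximal vacuum initial data with cosmological constant `Λ` on the 3-manifold `M`: a smooth
metric and a smooth symmetric tensor `K` which is trace-free and satisfies the constraints
`R = Kᵢⱼ Kⁱʲ + 2Λ` and `∇ᵢ Kⁱʲ = 0`. -/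
structure InitialData (Λ : ℝ) (M : Type*) [TopologicalSpace M] [ChartedSpace E3 M]
    [IsManifold (𝓡 3) ∞ M] where
  /-- the metric -/
  g : Metric M
  /-- the second fundamental form -/
  K : BilinField M
  smooth_K : ContMDiff (𝓡 3) ((𝓡 3).prod 𝓘(ℝ, E3 →L[ℝ] E3 →L[ℝ] ℝ)) ∞
    (fun x => Bundle.TotalSpace.mk' (E3 →L[ℝ] E3 →L[ℝ] ℝ)
      (E := fun x : M => TangentSpace (𝓡 3) x →L[ℝ] TangentSpace (𝓡 3) x →L[ℝ] ℝ) x (K x))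
  symm_K : ∀ (x : M) (v w : TangentSpace (𝓡 3) x), K x v w = K x w v
  maximal : ∀ x : M, trace g K x = 0
  hamiltonian : ∀ x : M, scalarCurvature g x = omegaSq g K x + 2 * Λ
  momentum : ∀ (x : M) (j : Fin 3), divergence g (chartAt E3 x) K j (chartAt E3 x x) = 0

namespace InitialData

variable {Λ : ℝ} {M : Type*} [TopologicalSpace M] [ChartedSpace E3 M] [IsManifold (𝓡 3) ∞ M]

/-- The function `Ω² = Kᵢⱼ Kⁱʲ` of the data. -/
def OmegaSq (D : InitialData Λ M) (x : M) : ℝ := omegaSq D.g D.K x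

/-- The volume of the data. -/
def volume [MeasurableSpace M] (D : InitialData Λ M) : ℝ := (vol D.g).real Set.univ

/-- `s` is the lowest eigenvalue of the data under conformal deformations, i.e. of `L_φ` at the
solution `φ ≡ 1` of the Lichnerowicz equation. -/
def HasLowestEigenvalue [MeasurableSpace M] (D : InitialData Λ M) (s : ℝ) : Prop :=
  IsLowestEigenvalue Λ D.g D.K (fun _ => 1) s

/-- The data are strictly unstable: their lowest eigenvalue is negative. -/
def StrictlyUnstable [MeasurableSpace M] (D : InitialData Λ M) : Prop :=
  ∃ s : ℝ, D.HasLowestEigenvalue s ∧ s < 0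

end InitialData

end MaximalData

end

/-! The Hamiltonian constraint turns the linearization at `φ ≡ 1` into the Schrödinger operator `-Δ
+ (Ω² - Λ)` (`linearized_one`): the terms `R/8`, `-5Λ/4` and `7Ω²/8` add up to `Ω² - Λ`. The
constant trial function has Rayleigh quotient equal to the mean of `Ω² - Λ`, so the lowest
eigenvalue `s` is at most that mean, which is claim 1. If `Ω² ≤ Λ` without equality everywhere,
continuity makes the mean negative, hence `s < 0`. If `Ω²` is a constant `k`, the mean is `k - Λ`,
and every eigenvalue of `-Δ + (k - Λ)` is at least `k - Λ` because the Dirichlet form is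
nonnegative, so `s = k - Λ`.

The trial function bounds the infimum of the Rayleigh quotient, while `s` is only known to be the
least among the weak eigenvalues. The substance is therefore that the infimum is attained
(`exists_weakEigenfunction`), by the direct method. A minimizing sequence of smooth functions is
bounded in `H¹`; Rellich's theorem (`exists_subseq_cauchy`) gives a subsequence converging in `L²`.
The energy form shifted by the infimum is nonnegative on smooth functions: its parallelogram
identity makes the gradients Cauchy, and its Cauchy-Schwarz inequality gives the weak eigenvalue
equation in the limit. No elliptic regularity enters. The lower bound
`IsWeakEigenfunction.le_of_const` works directly with the smooth functions approximating the weak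
eigenfunction.

This rests on calculus on the manifold: the volume has the expected density in each chart
(`vol_apply`), and Green's formula holds globally (`green`), by the divergence theorem in charts and
a partition of unity. Rellich's theorem is reduced by the same partition to `ℝ³`. There, weak
compactness of `L²` gives convergence of the averages over balls of a fixed radius, and a gradient
bound makes these averages uniformly close to the functions. -/

noncomputable section

namespace MaximalData

/-! ### Smoothness of tensor components in a chart -/

section CoordinateExpressions

variable {M : Type*} [TopologicalSpace M] [ChartedSpace E3 M] [IsManifold (𝓡 3) ∞ M]

/-- Smoothness of a field of bilinear forms. -/
def SmoothField (T : BilinField M) : Prop :=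
  ContMDiff (𝓡 3) ((𝓡 3).prod 𝓘(ℝ, E3 →L[ℝ] E3 →L[ℝ] ℝ)) ∞
    (fun x => Bundle.TotalSpace.mk' (E3 →L[ℝ] E3 →L[ℝ] ℝ)
      (E := fun x : M => TangentSpace (𝓡 3) x →L[ℝ] TangentSpace (𝓡 3) x →L[ℝ] ℝ) x (T x))

/-- The coordinate field is the tangent map of the inverse chart applied to a constant field on
`ℝ³`, and the tangent map of a smooth map is smooth. -/
lemma contMDiffOn_coordVec {c : OpenPartialHomeomorph M E3} (hc : c ∈ atlas E3 M) (i : Fin 3) :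
    ContMDiffOn (𝓡 3) (𝓡 3).tangent ∞
      (fun y => (⟨c.symm y, coordVec c i y⟩ : TangentBundle (𝓡 3) M)) c.target := by
  have h1 : ContMDiffOn (𝓡 3) (𝓡 3) ∞ c.symm c.target :=
    contMDiffOn_symm_of_mem_maximalAtlas (IsManifold.subset_maximalAtlas hc)
  have h2 := ContMDiffOn.contMDiffOn_tangentMapWithin (I := 𝓡 3) (I' := 𝓡 3) (m := ∞) h1
    (by simp) (c.open_target.uniqueMDiffOn (I := 𝓡 3))
  have h3 : ContMDiff (𝓡 3) (𝓡 3).tangent ∞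
      (fun y : E3 => (⟨y, EuclideanSpace.single i (1 : ℝ)⟩ : TangentBundle (𝓡 3) E3)) := by
    intro y
    rw [Bundle.contMDiffAt_totalSpace]
    refine ⟨contMDiffAt_id, ?_⟩
    have h : ContMDiffAt (𝓡 3) (𝓡 3) ∞
        (fun _ : E3 => (EuclideanSpace.single i (1 : ℝ) : E3)) y := contMDiffAt_const
    refine h.congr_of_eventuallyEq (Eventually.of_forall fun z => ?_)
    simp only [TangentBundle.trivializationAt_apply]
    simp [chartAt_self_eq]
  have h4 := h2.comp (h3.contMDiffOn (s := c.target)) (fun y hy => hy)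
  refine h4.congr fun y hy => ?_
  simp only [Function.comp, tangentMapWithin, coordVec]
  rw [mfderivWithin_of_isOpen c.open_target hy]

lemma SmoothField.contDiffOn_coeff {T : BilinField M} (hT : SmoothField T)
    {c : OpenPartialHomeomorph M E3} (hc : c ∈ atlas E3 M) (i j : Fin 3) :
    ContDiffOn ℝ ∞ (fun y => coeff T c y i j) c.target := by
  rw [← contMDiffOn_iff_contDiffOn]
  intro y hy
  have hb : ContMDiffWithinAt (𝓡 3) (𝓡 3) ∞ c.symm c.target y :=
    contMDiffOn_symm_of_mem_maximalAtlas (IsManifold.subset_maximalAtlas hc) y hy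
  have : ContMDiffWithinAt (𝓡 3) ((𝓡 3).prod 𝓘(ℝ)) ∞
      (fun m ↦ Bundle.TotalSpace.mk' ℝ (E := Bundle.Trivial M ℝ) (c.symm m)
        (T (c.symm m) (coordVec c i m) (coordVec c j m))) c.target y := by
    apply ContMDiffWithinAt.clm_bundle_apply₂ (F₁ := E3) (F₂ := E3)
      (E₁ := fun x : M => TangentSpace (𝓡 3) x) (E₂ := fun x : M => TangentSpace (𝓡 3) x)
    · exact ContMDiffAt.comp_contMDiffWithinAt y hT.contMDiffAt hb
    · exact contMDiffOn_coordVec hc i y hy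
    · exact contMDiffOn_coordVec hc j y hy
  simp only [Bundle.contMDiffWithinAt_totalSpace] at this
  exact this.2

end CoordinateExpressions

/-! ### Transformation laws under change of chart -/

section Transition

variable {M : Type*} [TopologicalSpace M] [ChartedSpace E3 M]

/-- The Jacobian matrix of a map of `ℝ³`. -/
def jacobian (f : E3 → E3) (y : E3) : Matrix (Fin 3) (Fin 3) ℝ :=
  Matrix.of fun k i => fderiv ℝ f y (EuclideanSpace.single i 1) k

lemma det_fderiv (f : E3 → E3) (y : E3) : (fderiv ℝ f y).det = (jacobian f y).det := by
  rw [ContinuousLinearMap.det, ← LinearMap.det_toMatrix (EuclideanSpace.basisFun (Fin 3) ℝ).toBasis]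
  congr 1

lemma eq_sum_single (v : E3) : v = ∑ k, v k • EuclideanSpace.single k (1 : ℝ) := by
  simpa using ((EuclideanSpace.basisFun (Fin 3) ℝ).sum_repr v).symm

/-- The differential of the inverse of a chart, as a map of `ℝ³`. -/
def chartDeriv (c : OpenPartialHomeomorph M E3) (y : E3) : E3 →L[ℝ] E3 :=
  mfderiv (𝓡 3) (𝓡 3) c.symm y

/-- A field of bilinear forms, seen as a form on `ℝ³`. -/
def form (T : BilinField M) (x : M) (v w : E3) : ℝ :=
  T x (v : TangentSpace (𝓡 3) x) (w : TangentSpace (𝓡 3) x)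

lemma form_sum_sum (T : BilinField M) (x : M) {ι : Type*} (s : Finset ι) (a b : ι → ℝ)
    (v w : ι → E3) :
    form T x (∑ k ∈ s, a k • v k) (∑ l ∈ s, b l • w l) =
      ∑ k ∈ s, ∑ l ∈ s, a k * b l * form T x (v k) (w l) := by
  have h1 : ∀ z : E3, form T x (∑ k ∈ s, a k • v k) z = ∑ k ∈ s, a k * form T x (v k) z := by
    intro z
    let A : E3 →L[ℝ] E3 →L[ℝ] ℝ := T x
    change A _ z = ∑ k ∈ s, a k * A (v k) z
    simp
  have h2 : ∀ z : E3, form T x z (∑ k ∈ s, b k • w k) = ∑ k ∈ s, b k * form T x z (w k) := by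
    intro z
    let A : E3 →L[ℝ] E3 →L[ℝ] ℝ := T x
    change A z _ = ∑ k ∈ s, b k * A z (w k)
    simp
  rw [h1]
  refine Finset.sum_congr rfl fun k _ => ?_
  rw [h2, Finset.mul_sum]
  exact Finset.sum_congr rfl fun l _ => by ring

lemma coeff_apply (T : BilinField M) (c : OpenPartialHomeomorph M E3) (y : E3) (i j : Fin 3) :
    coeff T c y i j = form T (c.symm y) (chartDeriv c y (EuclideanSpace.single i 1))
      (chartDeriv c y (EuclideanSpace.single j 1)) := rfl

lemma form_chartDeriv (T : BilinField M) (c : OpenPartialHomeomorph M E3) (y v w : E3) :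
    form T (c.symm y) (chartDeriv c y v) (chartDeriv c y w) =
      ∑ k, ∑ l, v k * w l * coeff T c y k l := by
  conv_lhs => rw [eq_sum_single v, eq_sum_single w]
  simp only [map_sum, map_smul]
  rw [form_sum_sum]
  rfl

variable [IsManifold (𝓡 3) ∞ M]

lemma contDiffOn_transition {c c' : OpenPartialHomeomorph M E3} (hc : c ∈ atlas E3 M)
    (hc' : c' ∈ atlas E3 M) : ContDiffOn ℝ ∞ (c.symm.trans c') (c.symm.trans c').source := by
  rw [← contMDiffOn_iff_contDiffOn]
  exact (contMDiffOn_of_mem_maximalAtlas (IsManifold.subset_maximalAtlas hc')).comp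
    ((contMDiffOn_symm_of_mem_maximalAtlas (IsManifold.subset_maximalAtlas hc)).mono
      (fun y hy => hy.1)) (fun y hy => hy.2)

lemma mdifferentiableAt_chart_symm {c : OpenPartialHomeomorph M E3} (hc : c ∈ atlas E3 M)
    {y : E3} (hy : y ∈ c.target) : MDifferentiableAt (𝓡 3) (𝓡 3) c.symm y :=
  ((contMDiffOn_symm_of_mem_maximalAtlas (I := 𝓡 3) (n := ∞)
    (IsManifold.subset_maximalAtlas hc)).contMDiffAt (c.open_target.mem_nhds hy)).mdifferentiableAt
    (by simp)

lemma mdifferentiableAt_chart {c : OpenPartialHomeomorph M E3} (hc : c ∈ atlas E3 M)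
    {x : M} (hx : x ∈ c.source) : MDifferentiableAt (𝓡 3) (𝓡 3) c x :=
  ((contMDiffOn_of_mem_maximalAtlas (I := 𝓡 3) (n := ∞)
    (IsManifold.subset_maximalAtlas hc)).contMDiffAt (c.open_source.mem_nhds hx)).mdifferentiableAt
    (by simp)

/-- The differential of the chart is a left inverse, by the chain rule for `c ∘ c.symm = id`.
Positivity of the metric thereby passes to its coordinate matrix. -/
lemma chartDeriv_injective {c : OpenPartialHomeomorph M E3} (hc : c ∈ atlas E3 M)
    {y : E3} (hy : y ∈ c.target) : Function.Injective (chartDeriv c y) := by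
  have h1 := (mdifferentiableAt_chart_symm hc hy).hasMFDerivAt
  have h2 := (mdifferentiableAt_chart hc (c.map_target hy)).hasMFDerivAt
  have h3 := h2.comp y h1
  have h4 : HasMFDerivAt (𝓡 3) (𝓡 3) (c ∘ c.symm) y (ContinuousLinearMap.id ℝ E3) := by
    refine (hasMFDerivAt_id y).congr_of_eventuallyEq ?_
    filter_upwards [c.open_target.mem_nhds hy] with z hz
    simp [c.right_inv hz]
  have h5 := hasMFDerivAt_unique h3 h4
  intro v w hvw
  have h6 : ∀ v : E3, mfderiv (𝓡 3) (𝓡 3) c (c.symm y) (chartDeriv c y v) = v := fun v => by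
    exact congrArg (fun (A : E3 →L[ℝ] E3) => A v) h5
  rw [← h6 v, hvw, h6 w]

/-- Chain rule for the factorization of `c.symm` through `c'.symm` and the transition map. -/
lemma chartDeriv_transition {c c' : OpenPartialHomeomorph M E3} (hc : c ∈ atlas E3 M)
    (hc' : c' ∈ atlas E3 M) {y : E3} (hy : y ∈ (c.symm.trans c').source) (v : E3) :
    chartDeriv c y v =
      chartDeriv c' (c.symm.trans c' y) (fderiv ℝ (c.symm.trans c') y v) := by
  have h0 : c.symm.trans c' y ∈ c'.target := (c.symm.trans c').map_source hy |>.1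
  have hd : DifferentiableAt ℝ (c.symm.trans c') y :=
    ((contDiffOn_transition hc hc').contDiffAt
      ((c.symm.trans c').open_source.mem_nhds hy)).differentiableAt (by simp)
  have h1 := (mdifferentiableAt_chart_symm hc' h0).hasMFDerivAt
  have h2 : HasMFDerivAt (𝓡 3) (𝓡 3) (c.symm.trans c') y (fderiv ℝ (c.symm.trans c') y) :=
    hd.hasFDerivAt.hasMFDerivAt
  have h3 := h1.comp y h2
  have h4 := (mdifferentiableAt_chart_symm hc hy.1).hasMFDerivAt
  have h5 : HasMFDerivAt (𝓡 3) (𝓡 3) (c'.symm ∘ (c.symm.trans c')) y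
      (mfderiv (𝓡 3) (𝓡 3) c.symm y) := by
    refine h4.congr_of_eventuallyEq ?_
    filter_upwards [(c.symm.trans c').open_source.mem_nhds hy] with z hz
    exact c'.left_inv hz.2
  exact congrArg (fun (A : E3 →L[ℝ] E3) => A v) (hasMFDerivAt_unique h5 h3)

lemma coeff_transition (T : BilinField M) {c c' : OpenPartialHomeomorph M E3}
    (hc : c ∈ atlas E3 M) (hc' : c' ∈ atlas E3 M) {y : E3}
    (hy : y ∈ (c.symm.trans c').source) :
    coeff T c y = (jacobian (c.symm.trans c') y)ᵀ * coeff T c' (c.symm.trans c' y) *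
      jacobian (c.symm.trans c') y := by
  ext i j
  have hx : c.symm y = c'.symm (c.symm.trans c' y) := (c'.left_inv hy.2).symm
  rw [coeff_apply, chartDeriv_transition hc hc' hy, chartDeriv_transition hc hc' hy, hx,
    form_chartDeriv]
  simp only [Matrix.mul_apply, Matrix.transpose_apply, jacobian, Matrix.of_apply, Finset.sum_mul]
  rw [Finset.sum_comm]
  exact Finset.sum_congr rfl fun k _ => Finset.sum_congr rfl fun l _ => by ring

lemma lowerG_isSymm (g : Metric M) (c : OpenPartialHomeomorph M E3) (y : E3) :
    (lowerG g c y).IsSymm := by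
  ext i j
  exact g.symm _ _ _

lemma lowerG_posDef (g : Metric M) {c : OpenPartialHomeomorph M E3} (hc : c ∈ atlas E3 M)
    {y : E3} (hy : y ∈ c.target) : (lowerG g c y).PosDef := by
  rw [Matrix.posDef_iff_dotProduct_mulVec]
  refine ⟨?_, fun v hv => ?_⟩
  · rw [Matrix.IsHermitian, Matrix.conjTranspose_eq_transpose_of_trivial]
    exact lowerG_isSymm g c y
  · have h : 0 < form g.inner (c.symm y) (chartDeriv c y (WithLp.toLp 2 v))
        (chartDeriv c y (WithLp.toLp 2 v)) := by
      refine g.pos _ _ fun h0 => hv ?_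
      have := chartDeriv_injective hc hy (a₁ := WithLp.toLp 2 v) (a₂ := 0)
        (by rw [map_zero]; exact h0)
      simpa using this
    rw [form_chartDeriv] at h
    simp only [star_trivial, dotProduct, Matrix.mulVec, Finset.mul_sum, lowerG]
    refine h.trans_eq (Finset.sum_congr rfl fun i _ => Finset.sum_congr rfl fun j _ => ?_)
    ring

lemma det_lowerG_pos (g : Metric M) {c : OpenPartialHomeomorph M E3} (hc : c ∈ atlas E3 M)
    {y : E3} (hy : y ∈ c.target) : 0 < (lowerG g c y).det :=
  (lowerG_posDef g hc hy).det_pos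

lemma lowerG_transition (g : Metric M) {c c' : OpenPartialHomeomorph M E3}
    (hc : c ∈ atlas E3 M) (hc' : c' ∈ atlas E3 M) {y : E3}
    (hy : y ∈ (c.symm.trans c').source) :
    lowerG g c y = (jacobian (c.symm.trans c') y)ᵀ * lowerG g c' (c.symm.trans c' y) *
      jacobian (c.symm.trans c') y :=
  coeff_transition g.inner hc hc' hy

/-- Determinants of `G = Jᵀ G' J`. The factor `|det J|` is the one in the change of variables
formula, whence the consistency of the chart measures. -/
lemma sqrtDet_transition (g : Metric M) {c c' : OpenPartialHomeomorph M E3}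
    (hc : c ∈ atlas E3 M) (hc' : c' ∈ atlas E3 M) {y : E3}
    (hy : y ∈ (c.symm.trans c').source) :
    sqrtDet g c y = |(jacobian (c.symm.trans c') y).det| * sqrtDet g c' (c.symm.trans c' y) := by
  rw [sqrtDet, lowerG_transition g hc hc' hy, Matrix.det_mul, Matrix.det_mul,
    Matrix.det_transpose, sqrtDet, ← Real.sqrt_sq_eq_abs, ← Real.sqrt_mul (sq_nonneg _)]
  congr 1
  ring

lemma det_jacobian_ne_zero (g : Metric M) {c c' : OpenPartialHomeomorph M E3}
    (hc : c ∈ atlas E3 M) (hc' : c' ∈ atlas E3 M) {y : E3}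
    (hy : y ∈ (c.symm.trans c').source) : (jacobian (c.symm.trans c') y).det ≠ 0 := by
  intro h
  have h1 := det_lowerG_pos g hc hy.1
  rw [lowerG_transition g hc hc' hy, Matrix.det_mul, h, mul_zero] at h1
  exact lt_irrefl _ h1

/-- In this form the inverse metric of the new chart can be replaced inside an invariant without the
inverse of the Jacobian appearing. -/
lemma upperG_transition (g : Metric M) {c c' : OpenPartialHomeomorph M E3}
    (hc : c ∈ atlas E3 M) (hc' : c' ∈ atlas E3 M) {y : E3}
    (hy : y ∈ (c.symm.trans c').source) :
    jacobian (c.symm.trans c') y * upperG g c y * (jacobian (c.symm.trans c') y)ᵀ =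
      upperG g c' (c.symm.trans c' y) := by
  have hJ : IsUnit (jacobian (c.symm.trans c') y).det := (det_jacobian_ne_zero g hc hc' hy).isUnit
  have hJ' : IsUnit (jacobian (c.symm.trans c') y)ᵀ.det := by rwa [Matrix.det_transpose]
  rw [upperG, lowerG_transition g hc hc' hy, Matrix.mul_inv_rev, Matrix.mul_inv_rev, upperG]
  rw [← Matrix.mul_assoc, Matrix.mul_nonsing_inv _ hJ, Matrix.one_mul, Matrix.mul_assoc,
    Matrix.nonsing_inv_mul _ hJ', Matrix.mul_one]

lemma upperG_isSymm (g : Metric M) (c : OpenPartialHomeomorph M E3) (y : E3) :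
    (upperG g c y).IsSymm := by
  rw [Matrix.IsSymm, upperG, Matrix.transpose_nonsing_inv, lowerG_isSymm g c y]

end Transition

/-! ### Smooth functions, and continuity read off in charts -/

section SmoothFunctions

variable {M : Type*} [TopologicalSpace M] [ChartedSpace E3 M]

lemma isSmooth_const (a : ℝ) : IsSmooth (fun _ : M => a) := contMDiff_const

lemma IsSmooth.add {u v : M → ℝ} (hu : IsSmooth u) (hv : IsSmooth v) : IsSmooth (u + v) :=
  ContMDiff.add hu hv

lemma IsSmooth.mul {u v : M → ℝ} (hu : IsSmooth u) (hv : IsSmooth v) : IsSmooth (u * v) :=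
  ContMDiff.mul hu hv

lemma IsSmooth.smul {u : M → ℝ} (hu : IsSmooth u) (a : ℝ) : IsSmooth (a • u) :=
  IsSmooth.mul (isSmooth_const a) hu

lemma IsSmooth.sub {u v : M → ℝ} (hu : IsSmooth u) (hv : IsSmooth v) : IsSmooth (u - v) :=
  ContMDiff.sub hu hv

omit [ChartedSpace E3 M] in
lemma mem_transition_source {c c' : OpenPartialHomeomorph M E3} {x : M} (hx : x ∈ c.source)
    (hx' : x ∈ c'.source) : c x ∈ (c.symm.trans c').source :=
  ⟨c.map_source hx, by simpa [c.left_inv hx] using hx'⟩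

/-- The global quantities are evaluated at each point in the preferred chart of that point, which
may jump from point to point. Continuity follows once a single chart can be used on a whole
neighbourhood. -/
lemma continuous_of_coord {F : M → ℝ} {f : OpenPartialHomeomorph M E3 → E3 → ℝ}
    (hf : ∀ c ∈ atlas E3 M, ContinuousOn (f c) c.target)
    (hF : ∀ c ∈ atlas E3 M, ∀ x ∈ c.source, F x = f c (c x)) : Continuous F := by
  rw [continuous_iff_continuousAt]
  intro x
  have hc := chart_mem_atlas E3 x
  have h : ContinuousOn F (chartAt E3 x).source := by
    refine ContinuousOn.congr ?_ (hF _ hc)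
    exact (hf _ hc).comp (chartAt E3 x).continuousOn (chartAt E3 x).mapsTo
  exact h.continuousAt ((chartAt E3 x).open_source.mem_nhds (mem_chart_source E3 x))

end SmoothFunctions

/-! ### Smoothness of the metric coefficients -/

section SmoothCoefficients

lemma contDiffOn_det {s : Set E3} {A : E3 → Matrix (Fin 3) (Fin 3) ℝ}
    (hA : ∀ i j, ContDiffOn ℝ ∞ (fun y => A y i j) s) :
    ContDiffOn ℝ ∞ (fun y => (A y).det) s := by
  simp only [Matrix.det_apply]
  refine ContDiffOn.sum fun σ _ => ContDiffOn.const_smul _ ?_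
  exact contDiffOn_prod fun i _ => hA _ _

/-- Cramer's rule: the entries are cofactors, themselves determinants of smooth matrices, divided by
the determinant. -/
lemma contDiffOn_inv {s : Set E3} {A : E3 → Matrix (Fin 3) (Fin 3) ℝ}
    (hA : ∀ i j, ContDiffOn ℝ ∞ (fun y => A y i j) s) (h0 : ∀ y ∈ s, (A y).det ≠ 0) (i j : Fin 3) :
    ContDiffOn ℝ ∞ (fun y => (A y)⁻¹ i j) s := by
  simp only [Matrix.inv_def, Matrix.smul_apply, Ring.inverse_eq_inv', Matrix.adjugate_apply,
    smul_eq_mul]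
  refine ((contDiffOn_det hA).inv h0).mul (contDiffOn_det fun k l => ?_)
  by_cases h : k = j
  · simpa [Matrix.updateRow_apply, h] using contDiffOn_const
  · simpa [Matrix.updateRow_apply, h] using hA k l

lemma contDiffOn_pd {s : Set E3} (hs : IsOpen s) {f : E3 → ℝ} (hf : ContDiffOn ℝ ∞ f s)
    (i : Fin 3) : ContDiffOn ℝ ∞ (pd i f) s :=
  (hf.fderiv_of_isOpen hs (m := ∞) (by simp)).clm_apply contDiffOn_const

lemma pd_eq_of_eventuallyEq {f h : E3 → ℝ} {y : E3} (hfh : f =ᶠ[𝓝 y] h) (i : Fin 3) :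
    pd i f y = pd i h y := by
  rw [pd, pd, hfh.fderiv_eq]

variable {M : Type*} [TopologicalSpace M] [ChartedSpace E3 M] [IsManifold (𝓡 3) ∞ M]

lemma contDiffOn_lowerG (g : Metric M) {c : OpenPartialHomeomorph M E3} (hc : c ∈ atlas E3 M)
    (i j : Fin 3) : ContDiffOn ℝ ∞ (fun y => lowerG g c y i j) c.target :=
  SmoothField.contDiffOn_coeff (T := g.inner) g.contMDiff hc i j

lemma contDiffOn_upperG (g : Metric M) {c : OpenPartialHomeomorph M E3} (hc : c ∈ atlas E3 M)
    (i j : Fin 3) : ContDiffOn ℝ ∞ (fun y => upperG g c y i j) c.target :=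
  contDiffOn_inv (contDiffOn_lowerG g hc) (fun _ hy => (det_lowerG_pos g hc hy).ne') i j

lemma sqrtDet_pos (g : Metric M) {c : OpenPartialHomeomorph M E3} (hc : c ∈ atlas E3 M)
    {y : E3} (hy : y ∈ c.target) : 0 < sqrtDet g c y :=
  Real.sqrt_pos.2 (det_lowerG_pos g hc hy)

lemma contDiffOn_sqrtDet (g : Metric M) {c : OpenPartialHomeomorph M E3} (hc : c ∈ atlas E3 M) :
    ContDiffOn ℝ ∞ (sqrtDet g c) c.target :=
  (contDiffOn_det (contDiffOn_lowerG g hc)).sqrt fun _ hy => (det_lowerG_pos g hc hy).ne'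

lemma IsSmooth.contDiffOn_comp_symm {u : M → ℝ} (hu : IsSmooth u)
    {c : OpenPartialHomeomorph M E3} (hc : c ∈ atlas E3 M) :
    ContDiffOn ℝ ∞ (fun w => u (c.symm w)) c.target := by
  rw [← contMDiffOn_iff_contDiffOn]
  exact hu.comp_contMDiffOn
    (contMDiffOn_symm_of_mem_maximalAtlas (IsManifold.subset_maximalAtlas hc))

lemma IsSmooth.differentiableAt_comp_symm {u : M → ℝ} (hu : IsSmooth u)
    {c : OpenPartialHomeomorph M E3} (hc : c ∈ atlas E3 M) {y : E3} (hy : y ∈ c.target) :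
    DifferentiableAt ℝ (fun w => u (c.symm w)) y :=
  ((hu.contDiffOn_comp_symm hc).contDiffAt (c.open_target.mem_nhds hy)).differentiableAt (by simp)

lemma IsSmooth.pd_transition {u : M → ℝ} (hu : IsSmooth u)
    {c c' : OpenPartialHomeomorph M E3} (hc : c ∈ atlas E3 M) (hc' : c' ∈ atlas E3 M) {y : E3}
    (hy : y ∈ (c.symm.trans c').source) (i : Fin 3) :
    pd i (fun w => u (c.symm w)) y =
      ∑ k, jacobian (c.symm.trans c') y k i *
        pd k (fun w => u (c'.symm w)) (c.symm.trans c' y) := by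
  have h0 : c.symm.trans c' y ∈ c'.target := (c.symm.trans c').map_source hy |>.1
  have hd : DifferentiableAt ℝ (c.symm.trans c') y :=
    ((contDiffOn_transition hc hc').contDiffAt
      ((c.symm.trans c').open_source.mem_nhds hy)).differentiableAt (by simp)
  have h1 : (fun w => u (c.symm w)) =ᶠ[𝓝 y] (fun w => u (c'.symm w)) ∘ (c.symm.trans c') := by
    filter_upwards [(c.symm.trans c').open_source.mem_nhds hy] with z hz
    exact congrArg u (c'.left_inv hz.2).symm
  rw [pd_eq_of_eventuallyEq h1, pd, fderiv_comp y (hu.differentiableAt_comp_symm hc' h0) hd,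
    ContinuousLinearMap.comp_apply, eq_sum_single (fderiv ℝ _ y _), map_sum]
  simp only [map_smul, smul_eq_mul]
  rfl

end SmoothCoefficients

/-! ### The gradient product and `Ω²` as chart-independent functions -/

section ScalarInvariants

variable {M : Type*} [TopologicalSpace M] [ChartedSpace E3 M] [IsManifold (𝓡 3) ∞ M]

/-- The coordinate expression `gⁱʲ ∂ᵢu ∂ⱼv`. -/
def coordGradInner (g : Metric M) (c : OpenPartialHomeomorph M E3) (u v : M → ℝ) (y : E3) : ℝ :=
  ∑ i, ∑ j, upperG g c y i j * pd i (fun w => u (c.symm w)) y * pd j (fun w => v (c.symm w)) y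

/-- The inner product of the gradients of two functions. -/
def gradInner (g : Metric M) (u v : M → ℝ) (x : M) : ℝ :=
  coordGradInner g (chartAt E3 x) u v (chartAt E3 x x)

/-- The coordinate expression `Kᵢⱼ Kⁱʲ`. -/
def coordOmegaSq (g : Metric M) (c : OpenPartialHomeomorph M E3) (K : BilinField M) (y : E3) : ℝ :=
  ∑ i, ∑ j, coeff K c y i j * raised g c K i j y

lemma gradSq_eq (g : Metric M) (u : M → ℝ) (x : M) : gradSq g u x = gradInner g u u x := rfl

lemma coordGradInner_eq_dotProduct (g : Metric M) (c : OpenPartialHomeomorph M E3)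
    (u v : M → ℝ) (y : E3) :
    coordGradInner g c u v y = (fun i => pd i (fun w => u (c.symm w)) y) ⬝ᵥ
      (upperG g c y *ᵥ fun j => pd j (fun w => v (c.symm w)) y) := by
  simp only [coordGradInner, dotProduct, Matrix.mulVec, Finset.mul_sum]
  exact Finset.sum_congr rfl fun i _ => Finset.sum_congr rfl fun j _ => by ring

/-- Differentials transform by `Jᵀ` and the inverse metric by `J · Jᵀ`, so the Jacobians match. -/
lemma coordGradInner_transition (g : Metric M) {u v : M → ℝ} (hu : IsSmooth u) (hv : IsSmooth v)
    {c c' : OpenPartialHomeomorph M E3} (hc : c ∈ atlas E3 M) (hc' : c' ∈ atlas E3 M) {y : E3}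
    (hy : y ∈ (c.symm.trans c').source) :
    coordGradInner g c u v y = coordGradInner g c' u v (c.symm.trans c' y) := by
  have h : ∀ w : M → ℝ, IsSmooth w → (fun i => pd i (fun z => w (c.symm z)) y) =
      (jacobian (c.symm.trans c') y)ᵀ *ᵥ
        fun i => pd i (fun z => w (c'.symm z)) (c.symm.trans c' y) := by
    intro w hw
    ext i
    rw [hw.pd_transition hc hc' hy]
    rfl
  rw [coordGradInner_eq_dotProduct, coordGradInner_eq_dotProduct, h u hu, h v hv,
    Matrix.mulVec_mulVec, ← upperG_transition g hc hc' hy, Matrix.mulVec_transpose,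
    ← Matrix.dotProduct_mulVec, Matrix.mulVec_mulVec, Matrix.mul_assoc]

/-- As a trace, the double contraction becomes invariant under change of chart by cyclicity. -/
lemma coordOmegaSq_eq_trace (g : Metric M) (c : OpenPartialHomeomorph M E3) (K : BilinField M)
    (y : E3) :
    coordOmegaSq g c K y =
      ((coeff K c y)ᵀ * upperG g c y * coeff K c y * (upperG g c y)ᵀ).trace := by
  rw [Matrix.mul_assoc, Matrix.mul_assoc]
  simp only [coordOmegaSq, raised, Matrix.trace, Matrix.diag, Matrix.mul_apply,
    Matrix.transpose_apply, Finset.mul_sum]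
  rw [Finset.sum_comm]
  exact Finset.sum_congr rfl fun i _ => Finset.sum_congr rfl fun j _ =>
    Finset.sum_congr rfl fun a _ => Finset.sum_congr rfl fun b _ => by ring

lemma coordOmegaSq_transition (g : Metric M) (K : BilinField M)
    {c c' : OpenPartialHomeomorph M E3} (hc : c ∈ atlas E3 M) (hc' : c' ∈ atlas E3 M) {y : E3}
    (hy : y ∈ (c.symm.trans c').source) :
    coordOmegaSq g c K y = coordOmegaSq g c' K (c.symm.trans c' y) := by
  rw [coordOmegaSq_eq_trace, coordOmegaSq_eq_trace, ← upperG_transition g hc hc' hy,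
    coeff_transition K hc hc' hy]
  simp only [Matrix.transpose_mul, Matrix.transpose_transpose]
  simp only [Matrix.mul_assoc]
  rw [Matrix.trace_mul_comm]
  simp only [Matrix.mul_assoc]

lemma gradInner_eq_coord (g : Metric M) {u v : M → ℝ} (hu : IsSmooth u) (hv : IsSmooth v)
    {c : OpenPartialHomeomorph M E3} (hc : c ∈ atlas E3 M) {x : M} (hx : x ∈ c.source) :
    gradInner g u v x = coordGradInner g c u v (c x) := by
  rw [gradInner, coordGradInner_transition g hu hv hc (chart_mem_atlas E3 x)
    (mem_transition_source hx (mem_chart_source E3 x))]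
  simp [c.left_inv hx]

lemma omegaSq_eq_coord (g : Metric M) (K : BilinField M)
    {c : OpenPartialHomeomorph M E3} (hc : c ∈ atlas E3 M) {x : M} (hx : x ∈ c.source) :
    omegaSq g K x = coordOmegaSq g c K (c x) := by
  rw [coordOmegaSq_transition g K hc (chart_mem_atlas E3 x)
    (mem_transition_source hx (mem_chart_source E3 x))]
  simp only [OpenPartialHomeomorph.coe_trans, Function.comp, c.left_inv hx]
  rfl

lemma contDiffOn_coordGradInner (g : Metric M) {u v : M → ℝ} (hu : IsSmooth u) (hv : IsSmooth v)
    {c : OpenPartialHomeomorph M E3} (hc : c ∈ atlas E3 M) :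
    ContDiffOn ℝ ∞ (coordGradInner g c u v) c.target :=
  ContDiffOn.sum fun i _ => ContDiffOn.sum fun j _ =>
    ((contDiffOn_upperG g hc i j).mul
      (contDiffOn_pd c.open_target (hu.contDiffOn_comp_symm hc) i)).mul
      (contDiffOn_pd c.open_target (hv.contDiffOn_comp_symm hc) j)

lemma continuous_gradInner (g : Metric M) {u v : M → ℝ} (hu : IsSmooth u) (hv : IsSmooth v) :
    Continuous (gradInner g u v) :=
  continuous_of_coord (fun _ hc => (contDiffOn_coordGradInner g hu hv hc).continuousOn)
    (fun _ hc _ hx => gradInner_eq_coord g hu hv hc hx)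

lemma continuous_omegaSq (g : Metric M) {K : BilinField M} (hK : SmoothField K) :
    Continuous (omegaSq g K) := by
  refine continuous_of_coord (f := fun c => coordOmegaSq g c K) (fun c hc => ?_)
    (fun _ hc _ hx => omegaSq_eq_coord g K hc hx)
  have hU := fun i j => (contDiffOn_upperG g hc i j).continuousOn
  have hk := fun i j => (hK.contDiffOn_coeff hc i j).continuousOn
  exact continuousOn_finsetSum _ fun i _ => continuousOn_finsetSum _ fun j _ =>
    (hk i j).mul (continuousOn_finsetSum _ fun a _ => continuousOn_finsetSum _ fun b _ =>
      ((hU i a).mul (hU j b)).mul (hk a b))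

lemma upperG_posDef (g : Metric M) {c : OpenPartialHomeomorph M E3} (hc : c ∈ atlas E3 M)
    {y : E3} (hy : y ∈ c.target) : (upperG g c y).PosDef :=
  (lowerG_posDef g hc hy).inv

lemma gradInner_self_nonneg (g : Metric M) (u : M → ℝ) (x : M) : 0 ≤ gradInner g u u x := by
  rw [gradInner, coordGradInner_eq_dotProduct]
  exact (upperG_posDef g (chart_mem_atlas E3 x)
    (mem_chart_target E3 x)).posSemidef.dotProduct_mulVec_nonneg _

lemma gradInner_comm (g : Metric M) (u v : M → ℝ) (x : M) :
    gradInner g u v x = gradInner g v u x := by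
  rw [gradInner, gradInner, coordGradInner, coordGradInner, Finset.sum_comm]
  refine Finset.sum_congr rfl fun i _ => Finset.sum_congr rfl fun j _ => ?_
  rw [(upperG_isSymm g _ _).apply]
  ring

lemma pd_add {f h : E3 → ℝ} {y : E3} (hf : DifferentiableAt ℝ f y) (hh : DifferentiableAt ℝ h y)
    (i : Fin 3) : pd i (fun z => f z + h z) y = pd i f y + pd i h y := by
  simp [pd, fderiv_fun_add hf hh]

lemma pd_const_mul {f : E3 → ℝ} {y : E3} (hf : DifferentiableAt ℝ f y) (a : ℝ)
    (i : Fin 3) : pd i (fun z => a * f z) y = a * pd i f y := by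
  simp [pd, fderiv_const_mul hf]

lemma pd_mul {f h : E3 → ℝ} {y : E3} (hf : DifferentiableAt ℝ f y) (hh : DifferentiableAt ℝ h y)
    (i : Fin 3) : pd i (fun z => f z * h z) y = f y * pd i h y + h y * pd i f y := by
  simp [pd, fderiv_fun_mul hf hh]

lemma gradInner_add_left (g : Metric M) {u v : M → ℝ} (w : M → ℝ) (hu : IsSmooth u)
    (hv : IsSmooth v) (x : M) :
    gradInner g (u + v) w x = gradInner g u w x + gradInner g v w x := by
  simp only [gradInner, coordGradInner, ← Finset.sum_add_distrib, Pi.add_apply]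
  refine Finset.sum_congr rfl fun i _ => Finset.sum_congr rfl fun j _ => ?_
  rw [pd_add (hu.differentiableAt_comp_symm (chart_mem_atlas E3 x) (mem_chart_target E3 x))
    (hv.differentiableAt_comp_symm (chart_mem_atlas E3 x) (mem_chart_target E3 x))]
  ring

lemma gradInner_smul_left (g : Metric M) {u : M → ℝ} (w : M → ℝ) (hu : IsSmooth u) (a : ℝ)
    (x : M) : gradInner g (a • u) w x = a * gradInner g u w x := by
  simp only [gradInner, coordGradInner, Finset.mul_sum, Pi.smul_apply, smul_eq_mul]
  refine Finset.sum_congr rfl fun i _ => Finset.sum_congr rfl fun j _ => ?_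
  rw [pd_const_mul (hu.differentiableAt_comp_symm (chart_mem_atlas E3 x) (mem_chart_target E3 x))]
  ring

lemma gradInner_const_left (g : Metric M) (a : ℝ) (w : M → ℝ) (x : M) :
    gradInner g (fun _ => a) w x = 0 := by
  simp [gradInner, coordGradInner, pd]

end ScalarInvariants

/-! ### The Riemannian volume measure -/

section ChartMeasure

variable {M : Type*} [TopologicalSpace M] [ChartedSpace E3 M] [IsManifold (𝓡 3) ∞ M]
  [MeasurableSpace M] [BorelSpace M]

/-- The Riemannian density, as a measure on the target of a chart. -/
def densityMeasure (g : Metric M) (c : OpenPartialHomeomorph M E3) : Measure E3 :=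
  (volume.restrict c.target).withDensity fun y => ENNReal.ofReal (sqrtDet g c y)

omit [ChartedSpace E3 M] [IsManifold (𝓡 3) ∞ M] in
lemma aemeasurable_chart_symm (c : OpenPartialHomeomorph M E3) :
    AEMeasurable c.symm (volume.restrict c.target) :=
  c.continuousOn_symm.aemeasurable c.open_target.measurableSet

lemma aemeasurable_chart_symm_density (g : Metric M) (c : OpenPartialHomeomorph M E3) :
    AEMeasurable c.symm (densityMeasure g c) :=
  (aemeasurable_chart_symm c).mono_ac (withDensity_absolutelyContinuous _ _)

omit [MeasurableSpace M] [BorelSpace M] in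
lemma aemeasurable_sqrtDet (g : Metric M) {c : OpenPartialHomeomorph M E3}
    (hc : c ∈ atlas E3 M) :
    AEMeasurable (fun y => ENNReal.ofReal (sqrtDet g c y)) (volume.restrict c.target) :=
  ((contDiffOn_sqrtDet g hc).continuousOn.aemeasurable c.open_target.measurableSet).ennreal_ofReal

omit [ChartedSpace E3 M] [IsManifold (𝓡 3) ∞ M] in
lemma measurableSet_chart_image (c : OpenPartialHomeomorph M E3) {s : Set M}
    (hs : MeasurableSet s) : MeasurableSet (c.symm ⁻¹' s ∩ c.target) := by
  rw [Set.inter_comm, ← Subtype.image_preimage_coe]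
  refine c.open_target.measurableSet.subtype_image ?_
  exact (continuousOn_iff_continuous_domRestrict.1 c.continuousOn_symm).measurable hs

lemma chartMeasure_apply (g : Metric M) (c : OpenPartialHomeomorph M E3) {s : Set M}
    (hs : MeasurableSet s) :
    chartMeasure g c s = ∫⁻ y in c.symm ⁻¹' s ∩ c.target, ENNReal.ofReal (sqrtDet g c y) := by
  rw [chartMeasure, ← densityMeasure, Measure.map_apply_of_aemeasurable
    (aemeasurable_chart_symm_density g c) hs, densityMeasure, withDensity_apply',
    Measure.restrict_restrict' c.open_target.measurableSet]

lemma chartMeasure_inter_source (g : Metric M) (c : OpenPartialHomeomorph M E3) {s : Set M}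
    (hs : MeasurableSet s) : chartMeasure g c (s ∩ c.source) = chartMeasure g c s := by
  rw [chartMeasure_apply g c hs, chartMeasure_apply g c (hs.inter c.open_source.measurableSet)]
  congr 2
  ext y
  simp only [Set.mem_inter_iff, Set.mem_preimage]
  exact ⟨fun h => ⟨h.1.1, h.2⟩, fun h => ⟨⟨h.1, c.map_target h.2⟩, h.2⟩⟩

lemma chartMeasure_transition (g : Metric M) {c c' : OpenPartialHomeomorph M E3}
    (hc : c ∈ atlas E3 M) (hc' : c' ∈ atlas E3 M) {s : Set M} (hs : MeasurableSet s)
    (h : s ⊆ c.source) (h' : s ⊆ c'.source) : chartMeasure g c s = chartMeasure g c' s := by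
  rw [chartMeasure_apply g c hs, chartMeasure_apply g c' hs]
  set τ := c.symm.trans c'
  have hsub : c.symm ⁻¹' s ∩ c.target ⊆ τ.source := fun y hy => ⟨hy.2, h' hy.1⟩
  have him : c'.symm ⁻¹' s ∩ c'.target = τ '' (c.symm ⁻¹' s ∩ c.target) := by
    ext z
    constructor
    · rintro ⟨hz, hzt⟩
      refine ⟨c (c'.symm z), ⟨?_, c.map_source (h hz)⟩, ?_⟩
      · simpa [c.left_inv (h hz)] using hz
      · simp [τ, c.left_inv (h hz), c'.right_inv hzt]
    · rintro ⟨y, ⟨hy, hyt⟩, rfl⟩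
      refine ⟨?_, c'.map_source (h' hy)⟩
      simpa [τ, c'.left_inv (h' hy)] using hy
  rw [him, lintegral_image_eq_lintegral_abs_det_fderiv_mul volume
    (measurableSet_chart_image c hs) (f' := fderiv ℝ τ)]
  · refine setLIntegral_congr_fun (measurableSet_chart_image c hs) fun y hy => ?_
    rw [← ENNReal.ofReal_mul (abs_nonneg _), det_fderiv,
      ← sqrtDet_transition g hc hc' (hsub hy)]
  · intro y hy
    exact (((contDiffOn_transition hc hc').contDiffAt
      (τ.open_source.mem_nhds (hsub hy))).differentiableAt
      (by simp)).hasFDerivAt.hasFDerivWithinAt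
  · exact τ.injOn.mono hsub

omit [BorelSpace M] in
lemma chartMeasure_le_vol (g : Metric M) {c : OpenPartialHomeomorph M E3}
    (hc : c ∈ atlas E3 M) : chartMeasure g c ≤ vol g :=
  le_iSup₂_of_le c hc le_rfl

/-- The supremum of the chart measures is bounded above by gluing them: `M` is cut into countably
many disjoint Borel pieces, each inside one chart, and each piece carries the measure of its chart.
The glued measure dominates every chart measure and agrees with it inside the chart. -/
lemma vol_apply [SecondCountableTopology M] (g : Metric M) {c : OpenPartialHomeomorph M E3}
    (hc : c ∈ atlas E3 M) {s : Set M} (hs : MeasurableSet s) (h : s ⊆ c.source) :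
    vol g s = chartMeasure g c s := by
  refine le_antisymm ?_ (chartMeasure_le_vol g hc s)
  rcases isEmpty_or_nonempty M with hM | hM
  · simp [Set.eq_empty_of_isEmpty s]
  obtain ⟨t, ht, hcov⟩ := TopologicalSpace.countable_cover_nhds
    (f := fun x : M => (chartAt E3 x).source) fun x => chart_source_mem_nhds E3 x
  have htne : t.Nonempty := by
    rw [Set.nonempty_iff_ne_empty]
    rintro rfl
    simp only [Set.mem_empty_iff_false, Set.iUnion_of_empty, Set.iUnion_empty] at hcov
    exact Set.empty_ne_univ hcov
  obtain ⟨p, rfl⟩ := ht.exists_eq_range htne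
  set d : ℕ → OpenPartialHomeomorph M E3 := fun n => chartAt E3 (p n)
  have hd : ∀ n, d n ∈ atlas E3 M := fun n => chart_mem_atlas E3 _
  -- Disjoint Borel pieces of a countable cover by chart domains.
  set A : ℕ → Set M := disjointed fun n => (d n).source
  have hAm : ∀ n, MeasurableSet (A n) :=
    MeasurableSet.disjointed fun n => (d n).open_source.measurableSet
  have hAd : Pairwise (Function.onFun Disjoint A) := disjoint_disjointed _
  have hAs : ∀ n, A n ⊆ (d n).source := fun n => disjointed_subset _ _
  have hAU : ⋃ n, A n = Set.univ := by
    rw [iUnion_disjointed, ← hcov, Set.biUnion_range]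
  have hsplit : ∀ (μ : Measure M) {u : Set M}, MeasurableSet u → μ u = ∑' n, μ (u ∩ A n) := by
    intro μ u hu
    rw [← measure_iUnion (fun i j hij => (hAd hij).mono Set.inter_subset_right
      Set.inter_subset_right) (fun n => hu.inter (hAm n)), ← Set.inter_iUnion, hAU, Set.inter_univ]
  set ν : Measure M := Measure.sum fun n => (chartMeasure g (d n)).restrict (A n)
  have hν : ∀ {u : Set M}, MeasurableSet u → ν u = ∑' n, chartMeasure g (d n) (u ∩ A n) := by
    intro u hu
    rw [Measure.sum_apply _ hu]
    exact tsum_congr fun n => Measure.restrict_apply hu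
  have hle : vol g ≤ ν := by
    refine iSup₂_le fun c' hc' => Measure.le_iff.2 fun u hu => ?_
    rw [hν hu, hsplit (chartMeasure g c') hu]
    refine ENNReal.tsum_le_tsum fun n => ?_
    have hm := hu.inter (hAm n)
    rw [← chartMeasure_inter_source g c' hm, chartMeasure_transition g hc' (hd n)
      (hm.inter c'.open_source.measurableSet) Set.inter_subset_right
      (fun x hx => hAs n hx.1.2)]
    exact measure_mono Set.inter_subset_left
  refine (hle s).trans_eq ?_
  rw [hν hs, hsplit (chartMeasure g c) hs]
  exact tsum_congr fun n => chartMeasure_transition g (hd n) hc (hs.inter (hAm n))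
    (fun x hx => hAs n hx.2) fun x hx => h hx.1

lemma vol_restrict_source [SecondCountableTopology M] (g : Metric M)
    {c : OpenPartialHomeomorph M E3} (hc : c ∈ atlas E3 M) :
    (vol g).restrict c.source = (densityMeasure g c).map c.symm := by
  ext s hs
  rw [Measure.restrict_apply hs, vol_apply g hc (hs.inter c.open_source.measurableSet)
    Set.inter_subset_right, chartMeasure_inter_source g c hs]
  rfl

lemma setIntegral_source [SecondCountableTopology M] (g : Metric M)
    {c : OpenPartialHomeomorph M E3} (hc : c ∈ atlas E3 M) {f : M → ℝ}
    (hf : AEStronglyMeasurable f ((vol g).restrict c.source)) :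
    ∫ x in c.source, f x ∂vol g = ∫ y in c.target, sqrtDet g c y * f (c.symm y) := by
  have hf' : AEStronglyMeasurable f ((densityMeasure g c).map c.symm) := by
    rw [← vol_restrict_source g hc]
    exact hf
  rw [vol_restrict_source g hc, integral_map (aemeasurable_chart_symm_density g c) hf',
    densityMeasure, integral_withDensity_eq_integral_toReal_smul₀ (aemeasurable_sqrtDet g hc)
      (by simp)]
  refine integral_congr_ae (Eventually.of_forall fun y => ?_)
  change (ENNReal.ofReal (sqrtDet g c y)).toReal * _ = _
  rw [ENNReal.toReal_ofReal (show 0 ≤ sqrtDet g c y from Real.sqrt_nonneg _)]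

/-- By compactness it suffices to have finite measure near each point, where the density is bounded
on a compact coordinate neighbourhood. -/
lemma isFiniteMeasure_vol [CompactSpace M] (g : Metric M) : IsFiniteMeasure (vol g) := by
  have := ChartedSpace.secondCountable_of_sigmaCompact E3 M
  refine ⟨isCompact_univ.measure_lt_top_of_nhdsWithin fun x _ => ?_⟩
  rw [nhdsWithin_univ]
  set c := chartAt E3 x
  have hc : c ∈ atlas E3 M := chart_mem_atlas E3 x
  obtain ⟨K, hK, hKt, hKc⟩ := local_compact_nhds
    (c.open_target.mem_nhds (mem_chart_target E3 x))
  obtain ⟨U, hUK, hUo, hxU⟩ := mem_nhds_iff.1 hK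
  have hopen : IsOpen (c.source ∩ c ⁻¹' U) := c.isOpen_inter_preimage hUo
  refine ⟨c.source ∩ c ⁻¹' U, hopen.mem_nhds ⟨mem_chart_source E3 x, hxU⟩, ?_⟩
  rw [vol_apply g hc hopen.measurableSet Set.inter_subset_left,
    chartMeasure_apply g c hopen.measurableSet]
  obtain ⟨C, hC⟩ := hKc.exists_bound_of_continuousOn
    ((contDiffOn_sqrtDet g hc).continuousOn.mono hKt)
  have hsub : c.symm ⁻¹' (c.source ∩ c ⁻¹' U) ∩ c.target ⊆ K := by
    rintro y ⟨⟨_, hy⟩, hyt⟩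
    rw [Set.mem_preimage, c.right_inv hyt] at hy
    exact hUK hy
  calc _ ≤ ∫⁻ _ in c.symm ⁻¹' (c.source ∩ c ⁻¹' U) ∩ c.target, ENNReal.ofReal C := by
        refine setLIntegral_mono' (measurableSet_chart_image c hopen.measurableSet) fun y hy => ?_
        exact ENNReal.ofReal_le_ofReal ((le_abs_self _).trans (hC y (hsub hy)))
    _ < ⊤ := by
        rw [setLIntegral_const]
        exact ENNReal.mul_lt_top ENNReal.ofReal_lt_top
          ((measure_mono hsub).trans_lt hKc.measure_lt_top)

/-- The density is strictly positive. Hence continuous functions that agree almost everywhere agree,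
and a nonempty `M` has positive volume. -/
lemma isOpenPosMeasure_vol [SecondCountableTopology M] (g : Metric M) :
    (vol g).IsOpenPosMeasure := by
  refine ⟨fun U hU hne h0 => ?_⟩
  obtain ⟨x, hx⟩ := hne
  set c := chartAt E3 x
  have hc : c ∈ atlas E3 M := chart_mem_atlas E3 x
  have hopen : IsOpen (c.symm ⁻¹' U ∩ c.target) := by
    rw [Set.inter_comm]
    exact c.symm.isOpen_inter_preimage hU
  have h1 : chartMeasure g c U = 0 := le_antisymm (h0 ▸ chartMeasure_le_vol g hc U) zero_le
  rw [chartMeasure_apply g c hU.measurableSet,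
    lintegral_eq_zero_iff' ((aemeasurable_sqrtDet g hc).mono_measure
      (Measure.restrict_mono Set.inter_subset_right le_rfl))] at h1
  have h2 : ∀ᵐ y ∂(volume.restrict (c.symm ⁻¹' U ∩ c.target)), False := by
    filter_upwards [h1, ae_restrict_mem hopen.measurableSet] with y hy hyt
    simp only [Pi.zero_apply, ENNReal.ofReal_eq_zero] at hy
    exact absurd (sqrtDet_pos g hc hyt.2) (not_lt.2 hy)
  rw [eventually_false_iff_eq_bot, ae_eq_bot, Measure.restrict_eq_zero] at h2
  refine hopen.measure_ne_zero volume ⟨c x, ?_, mem_chart_target E3 x⟩ h2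
  simpa [c] using hx

end ChartMeasure

/-! ### Compactly supported functions on `ℝ³` -/

section CompactSupport

lemma contDiff_of_support_subset {s K : Set E3} (hs : IsOpen s) (hK : IsCompact K) (hKs : K ⊆ s)
    {f : E3 → ℝ} (hf : ContDiffOn ℝ ∞ f s) (hsupp : Function.support f ⊆ K) :
    ContDiff ℝ ∞ f := by
  rw [contDiff_iff_contDiffAt]
  intro x
  by_cases hx : x ∈ s
  · exact hf.contDiffAt (hs.mem_nhds hx)
  · refine (contDiffAt_const (c := (0 : ℝ))).congr_of_eventuallyEq ?_
    filter_upwards [hK.isClosed.isOpen_compl.mem_nhds fun h => hx (hKs h)] with y hy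
    exact Function.notMem_support.1 fun h => hy (hsupp h)

lemma continuous_pd {f : E3 → ℝ} (hf : ContDiff ℝ ∞ f) (i : Fin 3) : Continuous (pd i f) :=
  (hf.continuous_fderiv (by simp)).clm_apply continuous_const

lemma pd_eq_zero_of_notMem {f : E3 → ℝ} {K : Set E3} (hK : IsClosed K)
    (hsupp : Function.support f ⊆ K) {y : E3} (hy : y ∉ K) (i : Fin 3) : pd i f y = 0 := by
  have h : f =ᶠ[𝓝 y] fun _ => (0 : ℝ) := by
    filter_upwards [hK.isOpen_compl.mem_nhds hy] with z hz
    exact Function.notMem_support.1 fun h => hz (hsupp h)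
  rw [pd_eq_of_eventuallyEq h]
  simp [pd]

lemma hasCompactSupport_pd {f : E3 → ℝ} (hc : HasCompactSupport f) (i : Fin 3) :
    HasCompactSupport (pd i f) :=
  hc.fderiv_apply ℝ _

/-- Integration by parts against the constant `1`. -/
lemma integral_pd_eq_zero {f : E3 → ℝ} (hf : ContDiff ℝ ∞ f) (hc : HasCompactSupport f)
    (i : Fin 3) : ∫ y, pd i f y = 0 := by
  have hi : Integrable (pd i f) :=
    (continuous_pd hf i).integrable_of_hasCompactSupport (hasCompactSupport_pd hc i)
  have hi' : Integrable f := hf.continuous.integrable_of_hasCompactSupport hc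
  have h := integral_mul_fderiv_eq_neg_fderiv_mul_of_integrable (μ := (volume : Measure E3))
    (f := fun _ => (1 : ℝ)) (g := f) (v := EuclideanSpace.single i 1) (by simp)
    (by simp only [one_mul]; exact hi) (by simpa using hi') (fun _ _ => differentiableAt_const _)
    (fun _ _ => hf.differentiable (by simp) _)
  simpa [pd] using h

lemma integrableOn_of_zero_off_compact {s K : Set E3} (hs : IsOpen s) (hK : IsCompact K)
    (hKs : K ⊆ s) {f : E3 → ℝ} (hf : ContinuousOn f s) (h0 : ∀ y ∈ s \ K, f y = 0) :
    IntegrableOn f s :=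
  ((hf.mono hKs).integrableOn_compact hK).of_forall_sdiff_eq_zero hs.measurableSet h0

end CompactSupport

/-! ### Green's formula in one chart -/

section LocalGreen

variable {M : Type*} [TopologicalSpace M] [ChartedSpace E3 M]

/-- The coordinate expression of a function supported in the domain of a chart, extended by zero
to `ℝ³`. -/
def chartExtend (c : OpenPartialHomeomorph M E3) (u : M → ℝ) : E3 → ℝ :=
  c.target.indicator fun y => u (c.symm y)

omit [ChartedSpace E3 M] in
lemma chartExtend_of_mem (c : OpenPartialHomeomorph M E3) (u : M → ℝ) {y : E3}
    (hy : y ∈ c.target) : chartExtend c u y = u (c.symm y) :=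
  Set.indicator_of_mem hy _

omit [ChartedSpace E3 M] in
lemma isCompact_chart_image [CompactSpace M] {c : OpenPartialHomeomorph M E3} {s : Set M}
    (hs : IsClosed s) (hsc : s ⊆ c.source) : IsCompact (c '' s) :=
  hs.isCompact.image_of_continuousOn (c.continuousOn.mono hsc)

omit [ChartedSpace E3 M] in
lemma chart_image_subset_target {c : OpenPartialHomeomorph M E3} {s : Set M}
    (hsc : s ⊆ c.source) : c '' s ⊆ c.target := by
  rintro _ ⟨x, hx, rfl⟩
  exact c.map_source (hsc hx)

omit [ChartedSpace E3 M] in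
lemma support_chartExtend {c : OpenPartialHomeomorph M E3} {u : M → ℝ} {s : Set M}
    (hu : Function.support u ⊆ s) : Function.support (chartExtend c u) ⊆ c '' s := by
  intro y hy
  have hyt : y ∈ c.target := by
    by_contra h
    exact hy (Set.indicator_of_notMem h _)
  rw [Function.mem_support, chartExtend_of_mem c u hyt] at hy
  exact ⟨c.symm y, hu hy, c.right_inv hyt⟩

variable [IsManifold (𝓡 3) ∞ M]

omit [ChartedSpace E3 M] [IsManifold (𝓡 3) ∞ M] in
lemma pd_chartExtend (c : OpenPartialHomeomorph M E3) (u : M → ℝ) {y : E3} (hy : y ∈ c.target)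
    (i : Fin 3) : pd i (chartExtend c u) y = pd i (fun w => u (c.symm w)) y := by
  refine pd_eq_of_eventuallyEq ?_ i
  filter_upwards [c.open_target.mem_nhds hy] with z hz
  exact chartExtend_of_mem c u hz

lemma IsSmooth.contDiff_chartExtend [CompactSpace M] {u : M → ℝ} (hu : IsSmooth u)
    {c : OpenPartialHomeomorph M E3} (hc : c ∈ atlas E3 M) {s : Set M} (hs : IsClosed s)
    (hsc : s ⊆ c.source) (hus : Function.support u ⊆ s) : ContDiff ℝ ∞ (chartExtend c u) := by
  refine contDiff_of_support_subset c.open_target (isCompact_chart_image hs hsc)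
    (chart_image_subset_target hsc) ?_ (support_chartExtend hus)
  exact (hu.contDiffOn_comp_symm hc).congr fun y hy => chartExtend_of_mem c u hy

/-- The flux `√(det g) gⁱʲ ∂ⱼu` of a function in coordinates. -/
def flux (g : Metric M) (c : OpenPartialHomeomorph M E3) (u : M → ℝ) (i : Fin 3) (z : E3) : ℝ :=
  sqrtDet g c z * ∑ j, upperG g c z i j * pd j (fun w => u (c.symm w)) z

lemma contDiffOn_flux (g : Metric M) {c : OpenPartialHomeomorph M E3} (hc : c ∈ atlas E3 M)
    {u : M → ℝ} (hu : IsSmooth u) (i : Fin 3) : ContDiffOn ℝ ∞ (flux g c u i) c.target :=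
  (contDiffOn_sqrtDet g hc).mul (ContDiffOn.sum fun j _ => (contDiffOn_upperG g hc i j).mul
    (contDiffOn_pd c.open_target (hu.contDiffOn_comp_symm hc) j))

lemma coordLaplacian_eq (g : Metric M) (c : OpenPartialHomeomorph M E3) (u : M → ℝ) (y : E3) :
    coordLaplacian g c u y = (sqrtDet g c y)⁻¹ * ∑ i, pd i (flux g c u i) y := rfl

lemma contDiffOn_coordLaplacian (g : Metric M) {c : OpenPartialHomeomorph M E3}
    (hc : c ∈ atlas E3 M) {u : M → ℝ} (hu : IsSmooth u) :
    ContDiffOn ℝ ∞ (coordLaplacian g c u) c.target :=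
  ((contDiffOn_sqrtDet g hc).inv fun _ hy => (sqrtDet_pos g hc hy).ne').mul
    (ContDiffOn.sum fun i _ => contDiffOn_pd c.open_target (contDiffOn_flux g hc hu i) i)

/-- The divergence theorem for the field `u · √(det g) ∇v`. The support of `u` alone makes it
compactly supported, so `v` may be any smooth function. -/
lemma coord_green [CompactSpace M] (g : Metric M) {c : OpenPartialHomeomorph M E3}
    (hc : c ∈ atlas E3 M) {u v : M → ℝ} (hu : IsSmooth u) (hv : IsSmooth v)
    (hus : tsupport u ⊆ c.source) :
    ∫ y in c.target, sqrtDet g c y * (u (c.symm y) * coordLaplacian g c v y) =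
      -∫ y in c.target, sqrtDet g c y * coordGradInner g c u v y := by
  set K := c '' tsupport u
  have hK : IsCompact K := isCompact_chart_image (isClosed_tsupport u) hus
  have hKt : K ⊆ c.target := chart_image_subset_target hus
  set h := chartExtend c u
  have hsm : ContDiff ℝ ∞ h := hu.contDiff_chartExtend hc (isClosed_tsupport u) hus subset_closure
  have hsupp : Function.support h ⊆ K := support_chartExtend subset_closure
  have hval : ∀ y ∈ c.target, h y = u (c.symm y) := fun y hy => chartExtend_of_mem c u hy
  have hpd : ∀ y ∈ c.target, ∀ i, pd i h y = pd i (fun w => u (c.symm w)) y := fun y hy i =>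
    pd_chartExtend c u hy i
  have hF : ∀ i, ContDiff ℝ ∞ (fun z => h z * flux g c v i z) := fun i =>
    contDiff_of_support_subset c.open_target hK hKt
      (hsm.contDiffOn.mul (contDiffOn_flux g hc hv i))
      ((Function.support_mul_subset_left _ _).trans hsupp)
  have hFs : ∀ i, Function.support (fun z => h z * flux g c v i z) ⊆ K := fun i =>
    (Function.support_mul_subset_left _ _).trans hsupp
  have hzero : ∀ i, ∫ y in c.target, pd i (fun z => h z * flux g c v i z) y = 0 := by
    intro i
    rw [setIntegral_eq_integral_of_forall_compl_eq_zero fun y hy =>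
      pd_eq_zero_of_notMem hK.isClosed (hFs i) (fun hyK => hy (hKt hyK)) i]
    exact integral_pd_eq_zero (hF i) (HasCompactSupport.of_support_subset_isCompact hK (hFs i)) i
  have hint : ∀ i, IntegrableOn (pd i (fun z => h z * flux g c v i z)) c.target := fun i =>
    integrableOn_of_zero_off_compact c.open_target hK hKt (continuous_pd (hF i) i).continuousOn
      fun y hy => pd_eq_zero_of_notMem hK.isClosed (hFs i) hy.2 i
  have hsum : ∫ y in c.target, ∑ i, pd i (fun z => h z * flux g c v i z) y = 0 := by
    rw [integral_finsetSum _ fun i _ => hint i]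
    exact Finset.sum_eq_zero fun i _ => hzero i
  have hpt : ∀ y ∈ c.target, ∑ i, pd i (fun z => h z * flux g c v i z) y =
      sqrtDet g c y * (u (c.symm y) * coordLaplacian g c v y) +
        sqrtDet g c y * coordGradInner g c u v y := by
    intro y hy
    have hd : ∀ i, DifferentiableAt ℝ (flux g c v i) y := fun i =>
      ((contDiffOn_flux g hc hv i).contDiffAt (c.open_target.mem_nhds hy)).differentiableAt
        (by simp)
    have h1 : ∀ i, pd i (fun z => h z * flux g c v i z) y =
        u (c.symm y) * pd i (flux g c v i) y +
          flux g c v i y * pd i (fun w => u (c.symm w)) y := by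
      intro i
      rw [pd_mul (hsm.differentiable (by simp) y) (hd i), hpd y hy, hval y hy]
    rw [Finset.sum_congr rfl fun i _ => h1 i, Finset.sum_add_distrib, ← Finset.mul_sum,
      coordLaplacian_eq]
    congr 1
    · field_simp [(sqrtDet_pos g hc hy).ne']
    · simp only [flux, coordGradInner, Finset.mul_sum, Finset.sum_mul]
      exact Finset.sum_congr rfl fun i _ => Finset.sum_congr rfl fun j _ => by ring
  rw [setIntegral_congr_fun c.open_target.measurableSet hpt, integral_add] at hsum
  · linarith
  · refine integrableOn_of_zero_off_compact c.open_target hK hKt ?_ fun y hy => ?_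
    · exact ((contDiffOn_sqrtDet g hc).mul ((hu.contDiffOn_comp_symm hc).mul
        (contDiffOn_coordLaplacian g hc hv))).continuousOn
    · have : h y = 0 := Function.notMem_support.1 fun hh => hy.2 (hsupp hh)
      rw [← hval y hy.1, this]
      ring
  · refine integrableOn_of_zero_off_compact c.open_target hK hKt ?_ fun y hy => ?_
    · exact ((contDiffOn_sqrtDet g hc).mul (contDiffOn_coordGradInner g hu hv hc)).continuousOn
    · rw [coordGradInner]
      simp only [← hpd y hy.1]
      simp [pd_eq_zero_of_notMem hK.isClosed hsupp hy.2]

end LocalGreen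

/-! ### The global Green formula -/

section GlobalGreen

variable {M : Type*} [TopologicalSpace M] [ChartedSpace E3 M] [IsManifold (𝓡 3) ∞ M]
  [CompactSpace M] [MeasurableSpace M] [BorelSpace M]

/-- The left side keeps the Laplacian of the chart `c`, and the right side is independent of `c`.
The chart independence of the Laplacian is deduced from this contrast. -/
lemma green_of_tsupport_subset (g : Metric M) {c : OpenPartialHomeomorph M E3}
    (hc : c ∈ atlas E3 M) {u v : M → ℝ} (hu : IsSmooth u) (hv : IsSmooth v)
    (hus : tsupport u ⊆ c.source) :
    ∫ x in c.source, u x * coordLaplacian g c v (c x) ∂vol g =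
      -∫ x, gradInner g u v x ∂vol g := by
  have := ChartedSpace.secondCountable_of_sigmaCompact E3 M
  have h0 : ∀ x ∉ c.source, gradInner g u v x = 0 := by
    intro x hx
    have h1 : u =ᶠ[𝓝 x] 0 := notMem_tsupport_iff_eventuallyEq.1 fun h => hx (hus h)
    have h2 : ∀ i, pd i (fun w => u ((chartAt E3 x).symm w)) (chartAt E3 x x) = 0 := by
      intro i
      have ht : Tendsto (chartAt E3 x).symm (𝓝 (chartAt E3 x x)) (𝓝 x) := by
        have := (chartAt E3 x).continuousAt_symm (mem_chart_target E3 x)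
        rwa [ContinuousAt, (chartAt E3 x).left_inv (mem_chart_source E3 x)] at this
      have h3 : (fun w => u ((chartAt E3 x).symm w)) =ᶠ[𝓝 (chartAt E3 x x)] fun _ => (0 : ℝ) :=
        ht.eventually h1
      rw [pd_eq_of_eventuallyEq h3]
      simp [pd]
    simp [gradInner, coordGradInner, h2]
  rw [← setIntegral_eq_integral_of_forall_compl_eq_zero h0, setIntegral_source g hc,
    setIntegral_source g hc (continuous_gradInner g hu hv).aestronglyMeasurable]
  · rw [setIntegral_congr_fun c.open_target.measurableSet
      (g := fun y => sqrtDet g c y * (u (c.symm y) * coordLaplacian g c v y)),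
      coord_green g hc hu hv hus, neg_inj]
    · refine setIntegral_congr_fun c.open_target.measurableSet fun y hy => ?_
      rw [gradInner_eq_coord g hu hv hc (c.map_target hy), c.right_inv hy]
    · intro y hy
      beta_reduce
      rw [c.right_inv hy]
  · refine ContinuousOn.aestronglyMeasurable ?_ c.open_source.measurableSet
    exact hu.continuous.continuousOn.mul
      ((contDiffOn_coordLaplacian g hc hv).continuousOn.comp c.continuousOn c.mapsTo)

variable [T2Space M]

/-- A weak argument replaces the transformation law of second derivatives: tested against any smooth
function supported in the overlap of two charts, both coordinate Laplacians give minus the same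
Dirichlet integral. They are continuous, so they coincide on the overlap. -/
lemma laplacian_eq_coord (g : Metric M) {u : M → ℝ} (hu : IsSmooth u)
    {c : OpenPartialHomeomorph M E3} (hc : c ∈ atlas E3 M) {x : M} (hx : x ∈ c.source) :
    laplacian g u x = coordLaplacian g c u (c x) := by
  have := ChartedSpace.secondCountable_of_sigmaCompact E3 M
  have := isFiniteMeasure_vol g
  have := isOpenPosMeasure_vol g
  set c' := chartAt E3 x
  have hc' : c' ∈ atlas E3 M := chart_mem_atlas E3 x
  set U := c'.source ∩ c.source
  have hU : IsOpen U := c'.open_source.inter c.open_source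
  have hA : ContinuousOn (fun z => coordLaplacian g c' u (c' z)) U :=
    ((contDiffOn_coordLaplacian g hc' hu).continuousOn.comp c'.continuousOn c'.mapsTo).mono
      Set.inter_subset_left
  have hB : ContinuousOn (fun z => coordLaplacian g c u (c z)) U :=
    ((contDiffOn_coordLaplacian g hc hu).continuousOn.comp c.continuousOn c.mapsTo).mono
      Set.inter_subset_right
  have : LocallyCompactSpace M := ChartedSpace.locallyCompactSpace E3 M
  have hae := hU.ae_eq_zero_of_integral_contMDiff_smul_eq_zero (𝓡 3) (μ := vol g)
    (f := fun z => coordLaplacian g c' u (c' z) - coordLaplacian g c u (c z))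
    ((hA.sub hB).locallyIntegrableOn hU.measurableSet) (by
      intro η hη _ hs
      have hη' : IsSmooth η := hη
      have hout : ∀ z ∉ U, η z = 0 := fun z hz =>
        image_eq_zero_of_notMem_tsupport fun h => hz (hs h)
      have hint : ∀ {F : M → ℝ}, ContinuousOn F U →
          IntegrableOn (fun z => η z * F z) U (vol g) := by
        intro F hF
        refine IntegrableOn.of_forall_sdiff_eq_zero (s := tsupport η)
          (ContinuousOn.integrableOn_compact (isClosed_tsupport η).isCompact
            (hη'.continuous.continuousOn.mul (hF.mono hs))) hU.measurableSet fun z hz => ?_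
        rw [image_eq_zero_of_notMem_tsupport hz.2, zero_mul]
      have key : ∀ e : OpenPartialHomeomorph M E3, e ∈ atlas E3 M → U ⊆ e.source →
          ∫ z in U, η z * coordLaplacian g e u (e z) ∂vol g =
            -∫ z, gradInner g η u z ∂vol g := by
        intro e he hUe
        rw [← green_of_tsupport_subset g he hη' hu (hs.trans hUe)]
        refine (setIntegral_eq_of_subset_of_forall_sdiff_eq_zero e.open_source.measurableSet hUe
          fun z hz => ?_).symm
        rw [hout z hz.2, zero_mul]
      rw [← setIntegral_eq_integral_of_forall_compl_eq_zero (s := U) fun z hz => by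
        rw [hout z hz, zero_smul]]
      simp only [smul_eq_mul, mul_sub]
      rw [integral_sub (hint hA) (hint hB), key c' hc' Set.inter_subset_left,
        key c hc Set.inter_subset_right, sub_self])
  have heq : Set.EqOn (fun z => coordLaplacian g c' u (c' z))
      (fun z => coordLaplacian g c u (c z)) U := by
    refine Measure.eqOn_open_of_ae_eq (μ := vol g) ?_ hU hA hB
    rw [EventuallyEq, ae_restrict_iff' hU.measurableSet]
    filter_upwards [hae] with z hz hzU
    exact sub_eq_zero.1 (hz hzU)
  exact heq ⟨mem_chart_source E3 x, hx⟩

lemma continuous_laplacian (g : Metric M) {u : M → ℝ} (hu : IsSmooth u) :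
    Continuous (laplacian g u) :=
  continuous_of_coord (fun _ hc => (contDiffOn_coordLaplacian g hc hu).continuousOn)
    (fun _ hc _ hx => laplacian_eq_coord g hu hc hx)

omit [MeasurableSpace M] [BorelSpace M] in
variable (M) in
/-- A finite smooth partition of unity subordinate to the preferred charts. -/
lemma exists_finite_partition : ∃ (t : Finset M) (χ : M → M → ℝ), (∀ i, IsSmooth (χ i)) ∧
    (∀ i, tsupport (χ i) ⊆ (chartAt E3 i).source) ∧ ∀ x, ∑ i ∈ t, χ i x = 1 := by
  obtain ⟨f, hf⟩ := SmoothPartitionOfUnity.exists_isSubordinate_chartAt_source (𝓡 3) M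
  have hfin := f.locallyFinite.finite_nonempty_of_compact
  refine ⟨hfin.toFinset, fun i => f i, fun i => (f i).contMDiff, hf, fun x => ?_⟩
  rw [← f.sum_eq_one (Set.mem_univ x)]
  refine (finsum_eq_sum_of_support_subset _ fun i hi => ?_).symm
  simp only [Set.Finite.coe_toFinset, Set.mem_ofPred_eq]
  exact ⟨x, hi⟩

omit [IsManifold (𝓡 3) ∞ M] [CompactSpace M] [MeasurableSpace M] [BorelSpace M] [T2Space M] in
lemma isSmooth_sum {ι : Type*} (t : Finset ι) {u : ι → M → ℝ} (hu : ∀ i, IsSmooth (u i)) :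
    IsSmooth (∑ i ∈ t, u i) := by
  classical
  induction t using Finset.induction_on with
  | empty => exact isSmooth_const 0
  | insert a t ha ih =>
    rw [Finset.sum_insert ha]
    exact (hu a).add ih

omit [CompactSpace M] [MeasurableSpace M] [BorelSpace M] [T2Space M] in
lemma gradInner_sum_left (g : Metric M) {ι : Type*} (t : Finset ι) {u : ι → M → ℝ} (w : M → ℝ)
    (hu : ∀ i, IsSmooth (u i)) (x : M) :
    gradInner g (∑ i ∈ t, u i) w x = ∑ i ∈ t, gradInner g (u i) w x := by
  classical
  induction t using Finset.induction_on with
  | empty => exact gradInner_const_left g 0 w x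
  | insert a t ha ih =>
    rw [Finset.sum_insert ha, Finset.sum_insert ha, gradInner_add_left g w (hu a)
      (isSmooth_sum t hu), ih]

omit [T2Space M] in
lemma integrable_of_continuous (g : Metric M) {F : M → ℝ} (hF : Continuous F) :
    Integrable F (vol g) := by
  have := isFiniteMeasure_vol g
  exact hF.integrable_of_hasCompactSupport (HasCompactSupport.of_compactSpace F)

/-- A partition of unity splits `u` into pieces supported in charts; both sides are linear in `u`.
-/
lemma green (g : Metric M) {u v : M → ℝ} (hu : IsSmooth u) (hv : IsSmooth v) :
    ∫ x, u x * laplacian g v x ∂vol g = -∫ x, gradInner g u v x ∂vol g := by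
  obtain ⟨t, χ, hχ, hsupp, hone⟩ := exists_finite_partition M
  have hχu : ∀ i, IsSmooth (χ i * u) := fun i => (hχ i).mul hu
  have hdec : ∑ i ∈ t, χ i * u = u := by
    ext x
    simp only [Finset.sum_apply, Pi.mul_apply, ← Finset.sum_mul, hone, one_mul]
  have hpiece : ∀ i, ∫ x, (χ i * u) x * laplacian g v x ∂vol g =
      -∫ x, gradInner g (χ i * u) v x ∂vol g := by
    intro i
    have hi : tsupport (χ i * u) ⊆ (chartAt E3 i).source :=
      (tsupport_mul_subset_left (f := χ i) (g := u)).trans (hsupp i)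
    rw [← green_of_tsupport_subset g (chart_mem_atlas E3 i) (hχu i) hv hi,
      ← setIntegral_eq_integral_of_forall_compl_eq_zero (s := (chartAt E3 i).source) fun x hx => by
        rw [image_eq_zero_of_notMem_tsupport fun h => hx (hi h), zero_mul]]
    refine setIntegral_congr_fun (chartAt E3 i).open_source.measurableSet fun x hx => ?_
    rw [laplacian_eq_coord g hv (chart_mem_atlas E3 i) hx]
  calc ∫ x, u x * laplacian g v x ∂vol g
      = ∫ x, ∑ i ∈ t, (χ i * u) x * laplacian g v x ∂vol g := by
        congr 1
        ext x
        rw [← Finset.sum_mul, ← Finset.sum_apply, hdec]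
    _ = ∑ i ∈ t, ∫ x, (χ i * u) x * laplacian g v x ∂vol g :=
        integral_finsetSum _ fun i _ => integrable_of_continuous g
          ((hχu i).continuous.mul (continuous_laplacian g hv))
    _ = -∑ i ∈ t, ∫ x, gradInner g (χ i * u) v x ∂vol g := by
        rw [← Finset.sum_neg_distrib]
        exact Finset.sum_congr rfl fun i _ => hpiece i
    _ = -∫ x, gradInner g u v x ∂vol g := by
        rw [← integral_finsetSum _ fun i _ => integrable_of_continuous g
          (continuous_gradInner g (hχu i) hv)]
        congr 2
        ext x
        rw [← gradInner_sum_left g t v hχu x, hdec]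

end GlobalGreen

/-! ### Cauchy-Schwarz and weak compactness in `L²` -/

section SquareIntegrals

/-- Cauchy-Schwarz against the constant `1`, from the nonnegativity of the integral of `(b f - m)²`.
-/
lemma sq_integral_le {α : Type*} [MeasurableSpace α] {μ : Measure α} [IsFiniteMeasure μ]
    {f : α → ℝ} (hf : Integrable f μ) (hf2 : Integrable (fun x => f x ^ 2) μ) :
    (∫ x, f x ∂μ) ^ 2 ≤ μ.real Set.univ * ∫ x, f x ^ 2 ∂μ := by
  set m := ∫ x, f x ∂μ
  set b := μ.real Set.univ
  have hb : 0 ≤ b := measureReal_nonneg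
  rcases hb.eq_or_lt with h0 | hpos
  · have hμ : μ = 0 := by
      rw [← Measure.measure_univ_eq_zero]
      exact (measureReal_eq_zero_iff (measure_ne_top _ _)).1 h0.symm
    simp [m, hμ]
  · have h1 : 0 ≤ ∫ x, (b * f x - m) ^ 2 ∂μ := integral_nonneg fun x => sq_nonneg _
    have h2 : ∫ x, (b * f x - m) ^ 2 ∂μ = b * (b * ∫ x, f x ^ 2 ∂μ - m ^ 2) := by
      have h3 : ∀ x, (b * f x - m) ^ 2 = (b ^ 2 * f x ^ 2 - 2 * b * m * f x) + m ^ 2 := fun x => by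
        ring
      simp only [h3]
      have hi1 : Integrable (fun x => b ^ 2 * f x ^ 2) μ := hf2.const_mul _
      have hi2 : Integrable (fun x => 2 * b * m * f x) μ := hf.const_mul _
      have hi3 : Integrable (fun x => b ^ 2 * f x ^ 2 - 2 * b * m * f x) μ := hi1.sub hi2
      rw [integral_add hi3 (integrable_const _), integral_sub hi1 hi2, integral_const_mul,
        integral_const_mul, integral_const, smul_eq_mul]
      ring
    rw [h2] at h1
    linarith [nonneg_of_mul_nonneg_right h1 hpos]

lemma eLpNorm_two_eq {α : Type*} [MeasurableSpace α] {μ : Measure α} {f : α → ℝ}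
    (hf : MemLp f 2 μ) : eLpNorm f 2 μ = ENNReal.ofReal √(∫ x, f x ^ 2 ∂μ) := by
  rw [hf.eLpNorm_eq_integral_rpow_norm (by simp) (by simp), Real.sqrt_eq_rpow]
  simp

/-- A bounded sequence in `L²` has a subsequence all of whose integrals over sets of finite
measure converge. -/
lemma exists_subseq_tendsto_setIntegral {f : ℕ → E3 → ℝ} (hf : ∀ n, MemLp (f n) 2 volume)
    {B : ℝ} (hB : ∀ n, ∫ y, f n y ^ 2 ≤ B) :
    ∃ φ : ℕ → ℕ, StrictMono φ ∧ ∀ s : Set E3, MeasurableSet s → volume s ≠ ⊤ →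
      ∃ l, Tendsto (fun n => ∫ y in s, f (φ n) y) atTop (𝓝 l) := by
  have : Fact ((2 : ENNReal) ≠ ⊤) := ⟨by simp⟩
  let H := Lp ℝ 2 (volume : Measure E3)
  let F : ℕ → H := fun n => (hf n).toLp (f n)
  have hnorm : ∀ n, ‖F n‖ ≤ √B := by
    intro n
    rw [Lp.norm_toLp, eLpNorm_two_eq (hf n), ENNReal.toReal_ofReal (Real.sqrt_nonneg _)]
    exact Real.sqrt_le_sqrt (hB n)
  have hmem : ∀ n, StrongDual.toWeakDual (InnerProductSpace.toDual ℝ H (F n)) ∈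
      WeakDual.toStrongDual ⁻¹' Metric.closedBall (0 : StrongDual ℝ H) √B := by
    intro n
    simpa using hnorm n
  -- Sequential Banach-Alaoglu in the separable space `L²`, identified with its dual by Riesz.
  -- Evaluating the weak limit at an indicator gives the limit of the integrals.
  obtain ⟨a, _, φ, hφ, hlim⟩ := WeakDual.isSeqCompact_closedBall ℝ H 0 √B hmem
  refine ⟨φ, hφ, fun s hs hμ => ⟨a (indicatorConstLp 2 hs hμ 1), ?_⟩⟩
  have h1 := ((WeakDual.eval_continuous (𝕜 := ℝ) (indicatorConstLp 2 hs hμ (1 : ℝ))).tendsto a).comp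
    hlim
  refine h1.congr fun n => ?_
  have h2 : (F (φ n) : E3 → ℝ) =ᵐ[volume] f (φ n) := (hf (φ n)).coeFn_toLp
  change inner ℝ (F (φ n)) (indicatorConstLp 2 hs hμ (1 : ℝ)) = _
  rw [real_inner_comm, L2.inner_indicatorConstLp_one]
  exact integral_congr_ae (ae_restrict_of_ae h2)

end SquareIntegrals

/-! ### Averages over balls controlled by the gradient -/

section TranslationEstimate

/-- The squared length of the Euclidean gradient. -/
def gradNormSq (f : E3 → ℝ) (y : E3) : ℝ := ∑ i, pd i f y ^ 2

lemma gradNormSq_nonneg (f : E3 → ℝ) (y : E3) : 0 ≤ gradNormSq f y :=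
  Finset.sum_nonneg fun _ _ => sq_nonneg _

lemma continuous_gradNormSq {f : E3 → ℝ} (hf : ContDiff ℝ ∞ f) : Continuous (gradNormSq f) :=
  continuous_finsetSum _ fun i _ => (continuous_pd hf i).pow 2

lemma hasCompactSupport_sq {f : E3 → ℝ} (hc : HasCompactSupport f) :
    HasCompactSupport fun y => f y ^ 2 := by
  simp only [pow_two]
  exact hc.mul_left

lemma integrable_sq {f : E3 → ℝ} (hf : Continuous f) (hc : HasCompactSupport f) :
    Integrable fun y => f y ^ 2 :=
  (hf.pow 2).integrable_of_hasCompactSupport (hasCompactSupport_sq hc)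

lemma integrable_gradNormSq {f : E3 → ℝ} (hf : ContDiff ℝ ∞ f) (hc : HasCompactSupport f) :
    Integrable (gradNormSq f) := by
  exact integrable_finsetSum _ fun i _ =>
    integrable_sq (continuous_pd hf i) (hasCompactSupport_pd hc i)

lemma sq_fderiv_le (f : E3 → ℝ) (y h : E3) :
    (fderiv ℝ f y h) ^ 2 ≤ ‖h‖ ^ 2 * gradNormSq f y := by
  conv_lhs => rw [eq_sum_single h, map_sum]
  simp only [map_smul, smul_eq_mul]
  rw [EuclideanSpace.real_norm_sq_eq]
  exact Finset.sum_mul_sq_le_sq_mul_sq _ _ _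

/-- The fundamental theorem of calculus along the segment from `y` to `y + h`, followed by
Cauchy-Schwarz. -/
lemma sq_translation_sub_le {f : E3 → ℝ} (hf : ContDiff ℝ ∞ f) (y h : E3) :
    (f (y + h) - f y) ^ 2 ≤ ∫ t in Set.Icc (0 : ℝ) 1, ‖h‖ ^ 2 * gradNormSq f (y + t • h) := by
  have hd : ∀ t : ℝ, HasDerivAt (fun t : ℝ => f (y + t • h)) (fderiv ℝ f (y + t • h) h) t := by
    intro t
    have h1 : HasDerivAt (fun t : ℝ => y + t • h) h t := by
      simpa using ((hasDerivAt_id t).smul_const h).const_add y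
    exact ((hf.differentiable (by simp) _).hasFDerivAt).comp_hasDerivAt t h1
  have hcont : Continuous fun t : ℝ => fderiv ℝ f (y + t • h) h :=
    ((hf.continuous_fderiv (by simp)).comp (by fun_prop)).clm_apply continuous_const
  have h2 : ∫ t in (0 : ℝ)..1, fderiv ℝ f (y + t • h) h = f (y + h) - f y := by
    rw [intervalIntegral.integral_eq_sub_of_hasDerivAt (fun t _ => hd t)
      (hcont.intervalIntegrable _ _)]
    simp
  rw [← h2, intervalIntegral.integral_of_le zero_le_one, ← integral_Icc_eq_integral_Ioc]
  have h3 := sq_integral_le (μ := volume.restrict (Set.Icc (0 : ℝ) 1))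
    (hcont.integrableOn_Icc) ((hcont.pow 2).integrableOn_Icc)
  refine h3.trans ?_
  have h4 : (volume.restrict (Set.Icc (0 : ℝ) 1)).real Set.univ = 1 := by simp
  rw [h4, one_mul]
  refine integral_mono (hcont.pow 2).integrableOn_Icc ?_ fun t => sq_fderiv_le f _ h
  exact (continuous_const.mul ((continuous_gradNormSq hf).comp (by fun_prop))).integrableOn_Icc

/-- Integrating the pointwise estimate in `y`: after Tonelli, translation invariance makes the inner
integral independent of `t`. -/
lemma lintegral_sq_translation_sub_le {f : E3 → ℝ} (hf : ContDiff ℝ ∞ f)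
    (hc : HasCompactSupport f) (h : E3) :
    ∫⁻ y, ENNReal.ofReal ((f (y + h) - f y) ^ 2) ≤
      ENNReal.ofReal (‖h‖ ^ 2 * ∫ y, gradNormSq f y) := by
  have hN := continuous_gradNormSq hf
  have hcont : Continuous fun p : E3 × ℝ => ‖h‖ ^ 2 * gradNormSq f (p.1 + p.2 • h) :=
    continuous_const.mul (hN.comp (by fun_prop))
  have hpt : ∀ y, ENNReal.ofReal ((f (y + h) - f y) ^ 2) ≤
      ∫⁻ t in Set.Icc (0 : ℝ) 1, ENNReal.ofReal (‖h‖ ^ 2 * gradNormSq f (y + t • h)) := by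
    intro y
    rw [← ofReal_integral_eq_lintegral_ofReal]
    · exact ENNReal.ofReal_le_ofReal (sq_translation_sub_le hf y h)
    · exact (continuous_const.mul (hN.comp (by fun_prop))).integrableOn_Icc
    · exact Eventually.of_forall fun t => mul_nonneg (sq_nonneg _) (gradNormSq_nonneg _ _)
  refine (lintegral_mono hpt).trans ?_
  rw [lintegral_lintegral_swap (hcont.measurable.ennreal_ofReal.aemeasurable)]
  have hin : ∀ t : ℝ, ∫⁻ y, ENNReal.ofReal (‖h‖ ^ 2 * gradNormSq f (y + t • h)) =
      ENNReal.ofReal (‖h‖ ^ 2 * ∫ y, gradNormSq f y) := by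
    intro t
    rw [lintegral_add_right_eq_self (fun y => ENNReal.ofReal (‖h‖ ^ 2 * gradNormSq f y)),
      ← integral_const_mul, ofReal_integral_eq_lintegral_ofReal
        ((integrable_gradNormSq hf hc).const_mul _)
        (Eventually.of_forall fun t => mul_nonneg (sq_nonneg _) (gradNormSq_nonneg _ _))]
  simp only [hin]
  rw [setLIntegral_const]
  simp

/-- The integral of a function over the closed ball of radius `r` about a point. -/
def ballIntegral (r : ℝ) (f : E3 → ℝ) (y : E3) : ℝ := ∫ h in Metric.closedBall (0 : E3) r, f (y + h)

lemma ballIntegral_eq (r : ℝ) (f : E3 → ℝ) (y : E3) :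
    ballIntegral r f y = ∫ z in Metric.closedBall y r, f z := by
  rw [ballIntegral, ← integral_indicator measurableSet_closedBall,
    ← integral_indicator measurableSet_closedBall,
    ← integral_add_left_eq_self (fun z => (Metric.closedBall y r).indicator f z) y]
  congr 1
  ext h
  simp [Set.indicator]

lemma continuous_ballIntegral (r : ℝ) {f : E3 → ℝ} (hf : Continuous f) :
    Continuous (ballIntegral r f) :=
  continuous_parametric_integral_of_continuous (f := fun y h => f (y + h))
    (hf.comp (continuous_fst.add continuous_snd)) (isCompact_closedBall 0 r)

lemma support_ballIntegral (r : ℝ) {f : E3 → ℝ} {K : Set E3}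
    (hs : Function.support f ⊆ K) :
    Function.support (ballIntegral r f) ⊆ Metric.cthickening r K := by
  intro y hy
  by_contra hyK
  refine hy ?_
  rw [ballIntegral_eq]
  refine setIntegral_eq_zero_of_forall_eq_zero fun z hz => Function.notMem_support.1 fun hzs => ?_
  refine hyK (Metric.mem_cthickening_of_dist_le y z r K (hs hzs) ?_)
  rw [dist_comm]
  exact hz

/-- A bound uniform in `y`, which serves as the dominating constant in the proof of Rellich's
theorem. -/
lemma sq_ballIntegral_le (r : ℝ) {f : E3 → ℝ} (hf : Continuous f) (hc : HasCompactSupport f)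
    (y : E3) : ballIntegral r f y ^ 2 ≤
      volume.real (Metric.closedBall (0 : E3) r) * ∫ z, f z ^ 2 := by
  have hfin : IsFiniteMeasure (volume.restrict (Metric.closedBall (0 : E3) r)) :=
    isFiniteMeasure_restrict.2 (isCompact_closedBall (0 : E3) r).measure_ne_top
  have hy : Continuous fun h => f (y + h) := hf.comp (by fun_prop)
  refine (sq_integral_le (hy.continuousOn.integrableOn_compact (isCompact_closedBall 0 r))
    ((hy.pow 2).continuousOn.integrableOn_compact (isCompact_closedBall 0 r))).trans ?_
  rw [measureReal_restrict_apply_univ, ← integral_add_left_eq_self (fun z => f z ^ 2) y]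
  refine mul_le_mul_of_nonneg_left ?_ measureReal_nonneg
  refine setIntegral_le_integral ?_ (Eventually.of_forall fun z => sq_nonneg _)
  exact (integrable_sq hf hc).comp_add_left y

/-- Up to sign, the difference is the integral of `f (y + h) - f y` over the ball. Cauchy-Schwarz in
`h` costs one ball volume, and integrating the translation estimate over `‖h‖ ≤ r` costs the second.
-/
lemma integral_sq_sub_ballIntegral_le (r : ℝ) {f : E3 → ℝ} (hf : ContDiff ℝ ∞ f)
    (hc : HasCompactSupport f) :
    ∫ y, (volume.real (Metric.closedBall (0 : E3) r) * f y - ballIntegral r f y) ^ 2 ≤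
      volume.real (Metric.closedBall (0 : E3) r) ^ 2 * r ^ 2 * ∫ y, gradNormSq f y := by
  set β := volume.real (Metric.closedBall (0 : E3) r)
  have hβ : 0 ≤ β := measureReal_nonneg
  set G := ∫ y, gradNormSq f y
  have hG : 0 ≤ G := integral_nonneg fun y => gradNormSq_nonneg f y
  have hfin : IsFiniteMeasure (volume.restrict (Metric.closedBall (0 : E3) r)) :=
    isFiniteMeasure_restrict.2 (isCompact_closedBall (0 : E3) r).measure_ne_top
  have hfc := hf.continuous
  have hpt : ∀ y, ENNReal.ofReal ((β * f y - ballIntegral r f y) ^ 2) ≤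
      ∫⁻ h in Metric.closedBall (0 : E3) r, ENNReal.ofReal (β * (f (y + h) - f y) ^ 2) := by
    intro y
    have hy : Continuous fun h => f (y + h) - f y := (hfc.comp (by fun_prop)).sub continuous_const
    have hi := hy.continuousOn.integrableOn_compact (μ := volume) (isCompact_closedBall (0 : E3) r)
    have hi2 : IntegrableOn (fun h => (f (y + h) - f y) ^ 2) (Metric.closedBall (0 : E3) r) :=
      (hy.pow 2).continuousOn.integrableOn_compact (isCompact_closedBall (0 : E3) r)
    have hyi : IntegrableOn (fun h => f (y + h)) (Metric.closedBall (0 : E3) r) :=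
      ((hfc.comp (by fun_prop)).continuousOn (f := fun h => f (y + h))).integrableOn_compact
        (isCompact_closedBall 0 r)
    rw [← ofReal_integral_eq_lintegral_ofReal (hi2.const_mul β)
      (Eventually.of_forall fun h => mul_nonneg hβ (sq_nonneg _)), integral_const_mul]
    refine ENNReal.ofReal_le_ofReal ?_
    have h1 := sq_integral_le hi hi2
    rw [measureReal_restrict_apply_univ, integral_sub hyi (integrable_const _), integral_const,
      measureReal_restrict_apply_univ, smul_eq_mul] at h1
    refine le_trans (le_of_eq ?_) h1
    rw [ballIntegral]
    ring
  have hcont : Continuous fun p : E3 × E3 => β * (f (p.1 + p.2) - f p.1) ^ 2 := by fun_prop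
  have hlin : ∫⁻ y, ENNReal.ofReal ((β * f y - ballIntegral r f y) ^ 2) ≤
      ENNReal.ofReal (β ^ 2 * r ^ 2 * G) := by
    refine (lintegral_mono hpt).trans ?_
    rw [lintegral_lintegral_swap (hcont.measurable.ennreal_ofReal.aemeasurable)]
    have hin : ∀ h ∈ Metric.closedBall (0 : E3) r,
        ∫⁻ y, ENNReal.ofReal (β * (f (y + h) - f y) ^ 2) ≤ ENNReal.ofReal (β * (r ^ 2 * G)) := by
      intro h hh
      simp only [ENNReal.ofReal_mul hβ]
      rw [lintegral_const_mul' _ _ ENNReal.ofReal_ne_top]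
      refine mul_le_mul_right ((lintegral_sq_translation_sub_le hf hc h).trans ?_) _
      refine ENNReal.ofReal_le_ofReal (mul_le_mul_of_nonneg_right ?_ hG)
      have : ‖h‖ ≤ r := by simpa using hh
      exact pow_le_pow_left₀ (norm_nonneg h) this 2
    refine (setLIntegral_mono' measurableSet_closedBall hin).trans (le_of_eq ?_)
    rw [setLIntegral_const, ← ofReal_measureReal (isCompact_closedBall (0 : E3) r).measure_ne_top,
      ← ENNReal.ofReal_mul (by positivity)]
    congr 1
    change β * (r ^ 2 * G) * β = _
    ring
  have hsm : Continuous fun y => (β * f y - ballIntegral r f y) ^ 2 :=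
    ((continuous_const.mul hfc).sub (continuous_ballIntegral r hfc)).pow 2
  rw [integral_eq_lintegral_of_nonneg_ae (Eventually.of_forall fun y => sq_nonneg _)
    hsm.aestronglyMeasurable]
  exact ENNReal.toReal_le_of_le_ofReal (by positivity) hlin

lemma integral_sq_le_ballIntegral_add {r : ℝ} (hr : 0 < r) {f : E3 → ℝ} (hf : ContDiff ℝ ∞ f)
    {K : Set E3} (hK : IsCompact K) (hs : Function.support f ⊆ K) :
    ∫ y, f y ^ 2 ≤ 2 * (volume.real (Metric.closedBall (0 : E3) r))⁻¹ ^ 2 *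
      (∫ y, ballIntegral r f y ^ 2) + 2 * r ^ 2 * ∫ y, gradNormSq f y := by
  have hc : HasCompactSupport f := HasCompactSupport.of_support_subset_isCompact hK hs
  set β := volume.real (Metric.closedBall (0 : E3) r)
  have hβ : 0 < β := ENNReal.toReal_pos (Metric.measure_closedBall_pos volume 0 hr).ne'
    (isCompact_closedBall (0 : E3) r).measure_ne_top
  have hS : HasCompactSupport (ballIntegral r f) :=
    HasCompactSupport.of_support_subset_isCompact hK.cthickening
      (support_ballIntegral r hs)
  have hSc := continuous_ballIntegral r hf.continuous
  have h1 := integral_sq_sub_ballIntegral_le r hf hc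
  have hi1 : Integrable fun y => (β * f y - ballIntegral r f y) ^ 2 :=
    integrable_sq ((continuous_const.mul hf.continuous).sub hSc) ((hc.mul_left).sub hS)
  have hi2 := integrable_sq hSc hS
  have h2 : ∫ y, (β * f y) ^ 2 ≤
      ∫ y, (2 * (β * f y - ballIntegral r f y) ^ 2 + 2 * ballIntegral r f y ^ 2) := by
    refine integral_mono (integrable_sq (continuous_const.mul hf.continuous) hc.mul_left)
      ((hi1.const_mul 2).add (hi2.const_mul 2)) fun y => ?_
    -- The hint is exactly the difference of the two sides.
    nlinarith [sq_nonneg (β * f y - 2 * ballIntegral r f y)]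
  rw [integral_add (hi1.const_mul 2) (hi2.const_mul 2), integral_const_mul,
    integral_const_mul] at h2
  simp only [mul_pow] at h2
  rw [integral_const_mul] at h2
  have h3 : β ^ 2 * ∫ y, f y ^ 2 ≤ β ^ 2 * (2 * β⁻¹ ^ 2 *
      (∫ y, ballIntegral r f y ^ 2) + 2 * r ^ 2 * ∫ y, gradNormSq f y) := by
    have h4 : β ^ 2 * (2 * β⁻¹ ^ 2 * (∫ y, ballIntegral r f y ^ 2) +
        2 * r ^ 2 * ∫ y, gradNormSq f y) =
        2 * (∫ y, ballIntegral r f y ^ 2) + 2 * (β ^ 2 * r ^ 2 * ∫ y, gradNormSq f y) := by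
      field_simp
    rw [h4]
    linarith
  exact le_of_mul_le_mul_left h3 (by positivity)

end TranslationEstimate

/-! ### Rellich's theorem in `ℝ³` -/

section EuclideanCompactness

lemma tendsto_sub_atTop_prod {a : ℕ → ℝ} {l : ℝ} (h : Tendsto a atTop (𝓝 l)) :
    Tendsto (fun p : ℕ × ℕ => a p.1 - a p.2) atTop (𝓝 0) := by
  rw [← prod_atTop_atTop_eq, ← sub_self l]
  exact (h.comp tendsto_fst).sub (h.comp tendsto_snd)

lemma gradNormSq_sub_le {f h : E3 → ℝ} (hf : ContDiff ℝ ∞ f) (hh : ContDiff ℝ ∞ h) (y : E3) :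
    gradNormSq (fun z => f z - h z) y ≤ 2 * gradNormSq f y + 2 * gradNormSq h y := by
  simp only [gradNormSq, Finset.mul_sum, ← Finset.sum_add_distrib]
  refine Finset.sum_le_sum fun i _ => ?_
  have : pd i (fun z => f z - h z) y = pd i f y - pd i h y := by
    simp [pd, fderiv_fun_sub (hf.differentiable (by simp) y) (hh.differentiable (by simp) y)]
  rw [this]
  nlinarith [sq_nonneg (pd i f y + pd i h y)]

/-- Rellich's theorem for smooth functions supported in a fixed compact subset of `ℝ³`. -/
lemma exists_subseq_cauchy_of_gradNormSq_bounded {f : ℕ → E3 → ℝ} (hf : ∀ n, ContDiff ℝ ∞ (f n))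
    {K : Set E3} (hK : IsCompact K) (hs : ∀ n, Function.support (f n) ⊆ K) {B : ℝ}
    (hB : ∀ n, ∫ y, f n y ^ 2 ≤ B) (hB' : ∀ n, ∫ y, gradNormSq (f n) y ≤ B) :
    ∃ φ : ℕ → ℕ, StrictMono φ ∧
      Tendsto (fun p : ℕ × ℕ => ∫ y, (f (φ p.1) y - f (φ p.2) y) ^ 2) atTop (𝓝 0) := by
  have hc : ∀ n, HasCompactSupport (f n) := fun n =>
    HasCompactSupport.of_support_subset_isCompact hK (hs n)
  have hmem : ∀ n, MemLp (f n) 2 volume := fun n =>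
    (hf n).continuous.memLp_of_hasCompactSupport (hc n)
  have hB0 : 0 ≤ B := (integral_nonneg fun y => sq_nonneg (f 0 y)).trans (hB 0)
  obtain ⟨φ, hφ, hlim⟩ := exists_subseq_tendsto_setIntegral hmem hB
  refine ⟨φ, hφ, ?_⟩
  set D : ℕ × ℕ → E3 → ℝ := fun p y => f (φ p.1) y - f (φ p.2) y
  have hD : ∀ p, ContDiff ℝ ∞ (D p) := fun p => (hf _).sub (hf _)
  have hDs : ∀ p, Function.support (D p) ⊆ K := fun p =>
    (Function.support_sub _ _).trans (Set.union_subset (hs _) (hs _))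
  have hDc : ∀ p, HasCompactSupport (D p) := fun p =>
    HasCompactSupport.of_support_subset_isCompact hK (hDs p)
  have hD2 : ∀ p, ∫ y, D p y ^ 2 ≤ 4 * B := by
    intro p
    have h1 := integrable_sq (hf (φ p.1)).continuous (hc (φ p.1))
    have h2 := integrable_sq (hf (φ p.2)).continuous (hc (φ p.2))
    have h3 : ∫ y, D p y ^ 2 ≤ ∫ y, (2 * f (φ p.1) y ^ 2 + 2 * f (φ p.2) y ^ 2) := by
      refine integral_mono (integrable_sq (hD p).continuous (hDc p))
        ((h1.const_mul 2).add (h2.const_mul 2)) fun y => ?_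
      simp only [D]
      nlinarith [sq_nonneg (f (φ p.1) y + f (φ p.2) y)]
    rw [integral_add (h1.const_mul 2) (h2.const_mul 2), integral_const_mul,
      integral_const_mul] at h3
    linarith [hB (φ p.1), hB (φ p.2)]
  have hDg : ∀ p, ∫ y, gradNormSq (D p) y ≤ 4 * B := by
    intro p
    have h1 := integrable_gradNormSq (hf (φ p.1)) (hc (φ p.1))
    have h2 := integrable_gradNormSq (hf (φ p.2)) (hc (φ p.2))
    have h3 : ∫ y, gradNormSq (D p) y ≤
        ∫ y, (2 * gradNormSq (f (φ p.1)) y + 2 * gradNormSq (f (φ p.2)) y) :=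
      integral_mono (integrable_gradNormSq (hD p) (hDc p)) ((h1.const_mul 2).add (h2.const_mul 2))
        fun y => gradNormSq_sub_le (hf _) (hf _) y
    rw [integral_add (h1.const_mul 2) (h2.const_mul 2), integral_const_mul,
      integral_const_mul] at h3
    linarith [hB' (φ p.1), hB' (φ p.2)]
  -- For fixed `r` the ball integrals of the differences tend to `0` at every point, since the
  -- integrals over each ball converge. They are bounded and supported in one compact set, so
  -- dominated convergence applies.
  have hball : ∀ r : ℝ, Tendsto (fun p => ∫ y, ballIntegral r (D p) y ^ 2) atTop (𝓝 0) := by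
    intro r
    set β := volume.real (Metric.closedBall (0 : E3) r)
    have hKr : IsCompact (Metric.cthickening r K) := hK.cthickening
    have h0 : ∫ _ : E3, (0 : ℝ) = 0 := integral_zero _ _
    rw [← h0]
    refine tendsto_integral_filter_of_dominated_convergence
      ((Metric.cthickening r K).indicator fun _ => β * (4 * B)) ?_ ?_ ?_ ?_
    · exact Eventually.of_forall fun p =>
        ((continuous_ballIntegral r (hD p).continuous).pow 2).aestronglyMeasurable
    · refine Eventually.of_forall fun p => Eventually.of_forall fun y => ?_
      rw [Real.norm_of_nonneg (sq_nonneg _)]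
      by_cases hy : y ∈ Metric.cthickening r K
      · rw [Set.indicator_of_mem hy]
        exact (sq_ballIntegral_le r (hD p).continuous (hDc p) y).trans
          (mul_le_mul_of_nonneg_left (hD2 p) measureReal_nonneg)
      · rw [Set.indicator_of_notMem hy, Function.notMem_support.1 fun h =>
          hy (support_ballIntegral r (hDs p) h)]
        simp
    · exact (integrable_indicator_iff hKr.measurableSet).2
        (integrableOn_const hKr.measure_ne_top)
    · refine Eventually.of_forall fun y => ?_
      obtain ⟨l, hl⟩ := hlim (Metric.closedBall y r) measurableSet_closedBall
        (isCompact_closedBall y r).measure_ne_top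
      have h1 := (tendsto_sub_atTop_prod hl).pow 2
      rw [zero_pow two_ne_zero] at h1
      refine h1.congr fun p => ?_
      rw [ballIntegral_eq, integral_sub]
      · exact ((hf _).continuous.integrable_of_hasCompactSupport (hc _)).integrableOn
      · exact ((hf _).continuous.integrable_of_hasCompactSupport (hc _)).integrableOn
  rw [Metric.tendsto_nhds]
  intro ε hε
  -- The radius is fixed first, to make the gradient term small uniformly in the pair of indices.
  -- The denominator has `B + 1` so that `B = 0` is allowed.
  obtain ⟨r, hr, hrε⟩ : ∃ r : ℝ, 0 < r ∧ 2 * r ^ 2 * (4 * B) < ε / 2 := by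
    refine ⟨√(ε / (32 * (B + 1))), by positivity, ?_⟩
    rw [Real.sq_sqrt (by positivity)]
    have h1 : 2 * (ε / (32 * (B + 1))) * (4 * B) = ε / 4 * (B / (B + 1)) := by
      field_simp
      ring
    have h2 : B / (B + 1) ≤ 1 := by
      rw [div_le_one (by positivity)]
      linarith
    rw [h1]
    nlinarith
  set β := volume.real (Metric.closedBall (0 : E3) r)
  have h1 := (hball r).const_mul (2 * β⁻¹ ^ 2)
  rw [mul_zero] at h1
  filter_upwards [h1.eventually_lt_const (half_pos hε)] with p hp
  rw [Real.dist_eq, sub_zero, abs_of_nonneg (integral_nonneg fun y => sq_nonneg _)]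
  have h2 := integral_sq_le_ballIntegral_add hr (hD p) hK (hDs p)
  have h3 := mul_le_mul_of_nonneg_left (hDg p) (by positivity : (0 : ℝ) ≤ 2 * r ^ 2)
  change ∫ y, D p y ^ 2 < ε
  linarith

/-- Successive extraction, one index at a time: a further subsequence keeps the Cauchy property
already obtained. -/
lemma exists_common_subseq {ι : Type*} (t : Finset ι) {f : ι → ℕ → E3 → ℝ}
    (hf : ∀ i n, ContDiff ℝ ∞ (f i n)) {K : ι → Set E3} (hK : ∀ i, IsCompact (K i))
    (hs : ∀ i n, Function.support (f i n) ⊆ K i) {B : ι → ℝ}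
    (hB : ∀ i n, ∫ y, f i n y ^ 2 ≤ B i) (hB' : ∀ i n, ∫ y, gradNormSq (f i n) y ≤ B i) :
    ∃ φ : ℕ → ℕ, StrictMono φ ∧ ∀ i ∈ t,
      Tendsto (fun p : ℕ × ℕ => ∫ y, (f i (φ p.1) y - f i (φ p.2) y) ^ 2) atTop (𝓝 0) := by
  classical
  induction t using Finset.induction_on with
  | empty => exact ⟨id, strictMono_id, by simp⟩
  | insert a t ha ih =>
    obtain ⟨φ, hφ, h1⟩ := ih
    obtain ⟨ψ, hψ, h2⟩ := exists_subseq_cauchy_of_gradNormSq_bounded (fun n => hf a (φ n)) (hK a)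
      (fun n => hs a (φ n)) (fun n => hB a (φ n)) (fun n => hB' a (φ n))
    refine ⟨φ ∘ ψ, hφ.comp hψ, fun i hi => ?_⟩
    rcases Finset.mem_insert.1 hi with rfl | hi
    · exact h2
    · have h3 : Tendsto (fun p : ℕ × ℕ => (ψ p.1, ψ p.2)) atTop atTop := by
        rw [← prod_atTop_atTop_eq]
        exact hψ.tendsto_atTop.prodMap hψ.tendsto_atTop
      exact (h1 i hi).comp h3

end EuclideanCompactness

/-! ### Linear algebra for comparing quadratic forms -/

section MetricComparison

open Matrix

lemma posSemidef_quadratic_add_le {A : Matrix (Fin 3) (Fin 3) ℝ} (hA : A.PosSemidef)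
    (a b : Fin 3 → ℝ) :
    (a + b) ⬝ᵥ (A *ᵥ (a + b)) ≤ 2 * (a ⬝ᵥ (A *ᵥ a)) + 2 * (b ⬝ᵥ (A *ᵥ b)) := by
  have h := hA.dotProduct_mulVec_nonneg (a - b)
  simp only [star_trivial, mulVec_sub, mulVec_add, dotProduct_sub, dotProduct_add, sub_dotProduct,
    add_dotProduct] at h ⊢
  linarith

/-- With `p = G w`, Cauchy-Schwarz for the form `G` gives `pᵢ² = (eᵢ · G w)² ≤ Gᵢᵢ (w · G w)`;
summing over `i` produces the trace. This bounds the Euclidean gradient by the Riemannian one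
without eigenvalues. -/
lemma sum_sq_le_trace_mul {G : Matrix (Fin 3) (Fin 3) ℝ} (hG : G.PosDef) (p : Fin 3 → ℝ) :
    ∑ i, p i ^ 2 ≤ G.trace * (p ⬝ᵥ (G⁻¹ *ᵥ p)) := by
  set w := G⁻¹ *ᵥ p
  have hp : G *ᵥ w = p := by
    rw [mulVec_mulVec, Matrix.mul_nonsing_inv _ hG.det_pos.ne'.isUnit, one_mulVec]
  have hsym : Gᵀ = G := by
    have := hG.isHermitian
    rwa [Matrix.IsHermitian, conjTranspose_eq_transpose_of_trivial] at this
  rw [Matrix.trace, Finset.sum_mul]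
  refine Finset.sum_le_sum fun i _ => ?_
  have hquad : ∀ t : ℝ, 0 ≤ G i i * (t * t) + (2 * p i) * t + p ⬝ᵥ w := by
    intro t
    have h := hG.posSemidef.dotProduct_mulVec_nonneg (w + t • Pi.single i 1)
    have h1 : w ⬝ᵥ G *ᵥ (Pi.single i 1) = p i := by
      rw [dotProduct_mulVec, ← mulVec_transpose, hsym, hp, dotProduct_single, mul_one]
    have h2 : (Pi.single i 1 : Fin 3 → ℝ) ⬝ᵥ G *ᵥ (Pi.single i 1) = G i i := by
      simp
    have h3 : (Pi.single i 1 : Fin 3 → ℝ) ⬝ᵥ G *ᵥ w = p i := by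
      rw [hp, single_dotProduct, one_mul]
    have h4 : w ⬝ᵥ G *ᵥ w = p ⬝ᵥ w := by rw [hp, dotProduct_comm]
    simp only [star_trivial, mulVec_add, mulVec_smul, dotProduct_add, add_dotProduct,
      smul_dotProduct, dotProduct_smul, h1, h2, h3, h4, smul_eq_mul] at h
    linarith
  have h := discrim_le_zero hquad
  rw [discrim] at h
  simp only [Matrix.diag]
  linarith

end MetricComparison

/-! ### Euclidean against Riemannian norms in a chart -/

section ChartComparison

variable {M : Type*} [TopologicalSpace M] [ChartedSpace E3 M] [IsManifold (𝓡 3) ∞ M]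

lemma gradInner_mul_self_le (g : Metric M) {χ v : M → ℝ} (hχ : IsSmooth χ) (hv : IsSmooth v)
    (x : M) : gradInner g (χ * v) (χ * v) x ≤
      2 * (χ x ^ 2 * gradInner g v v x) + 2 * (v x ^ 2 * gradInner g χ χ x) := by
  set c := chartAt E3 x
  have hc : c ∈ atlas E3 M := chart_mem_atlas E3 x
  have hx : c.symm (c x) = x := c.left_inv (mem_chart_source E3 x)
  have hpd : (fun i => pd i (fun w => (χ * v) (c.symm w)) (c x)) =
      χ x • (fun i => pd i (fun w => v (c.symm w)) (c x)) +
        v x • (fun i => pd i (fun w => χ (c.symm w)) (c x)) := by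
    ext i
    simp only [Pi.mul_apply, Pi.add_apply, Pi.smul_apply, smul_eq_mul]
    rw [pd_mul (hχ.differentiableAt_comp_symm hc (mem_chart_target E3 x))
      (hv.differentiableAt_comp_symm hc (mem_chart_target E3 x)), hx]
  have h := posSemidef_quadratic_add_le
    (upperG_posDef g hc (mem_chart_target E3 x)).posSemidef
    (χ x • (fun i => pd i (fun w => v (c.symm w)) (c x)))
    (v x • (fun i => pd i (fun w => χ (c.symm w)) (c x)))
  simp only [gradInner]
  rw [coordGradInner_eq_dotProduct, coordGradInner_eq_dotProduct, coordGradInner_eq_dotProduct]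
  change (fun i => pd i (fun w => (χ * v) (c.symm w)) (c x)) ⬝ᵥ (upperG g c (c x) *ᵥ
    (fun i => pd i (fun w => (χ * v) (c.symm w)) (c x))) ≤ _
  rw [hpd]
  refine h.trans (le_of_eq ?_)
  simp only [Matrix.mulVec_smul, smul_dotProduct, dotProduct_smul, smul_eq_mul]
  ring

lemma gradNormSq_le_trace_mul (g : Metric M) {c : OpenPartialHomeomorph M E3}
    (hc : c ∈ atlas E3 M) (u : M → ℝ) {y : E3} (hy : y ∈ c.target) :
    gradNormSq (chartExtend c u) y ≤ (lowerG g c y).trace * coordGradInner g c u u y := by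
  rw [coordGradInner_eq_dotProduct]
  simp only [gradNormSq, pd_chartExtend c u hy]
  exact sum_sq_le_trace_mul (lowerG_posDef g hc hy) _

variable [CompactSpace M] [MeasurableSpace M] [BorelSpace M]

lemma setIntegral_chart (g : Metric M) {c : OpenPartialHomeomorph M E3} (hc : c ∈ atlas E3 M)
    {S : Set M} (hS : IsClosed S) (hSc : S ⊆ c.source) {F : M → ℝ} (hF : Continuous F) :
    ∫ x in S, F x ∂vol g = ∫ y in c '' S, sqrtDet g c y * F (c.symm y) := by
  have := ChartedSpace.secondCountable_of_sigmaCompact E3 M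
  have hK : MeasurableSet (c '' S) := (isCompact_chart_image hS hSc).measurableSet
  have h1 : ∫ x in c.source, S.indicator F x ∂vol g = ∫ x in S, F x ∂vol g := by
    rw [setIntegral_indicator hS.measurableSet, Set.inter_eq_self_of_subset_right hSc]
  have h2 : ∫ y in c.target, (c '' S).indicator (fun y => sqrtDet g c y * F (c.symm y)) y =
      ∫ y in c '' S, sqrtDet g c y * F (c.symm y) := by
    rw [setIntegral_indicator hK, Set.inter_eq_self_of_subset_right (chart_image_subset_target hSc)]
  rw [← h1, ← h2, setIntegral_source g hc
    (hF.aestronglyMeasurable.indicator hS.measurableSet)]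
  refine setIntegral_congr_fun c.open_target.measurableSet fun y hy => ?_
  by_cases h : c.symm y ∈ S
  · have h' : y ∈ c '' S := ⟨c.symm y, h, c.right_inv hy⟩
    simp [h, h']
  · have h' : y ∉ c '' S := by
      rintro ⟨x, hx, rfl⟩
      exact h (by rwa [c.left_inv (hSc hx)])
    simp [h, h']

/-- On the compact image of `S` the density is bounded above and away from zero, and the trace of
the metric is bounded. One constant then serves all functions supported in `S`. -/
lemma exists_chart_comparison (g : Metric M) {c : OpenPartialHomeomorph M E3}
    (hc : c ∈ atlas E3 M) {S : Set M} (hS : IsClosed S) (hSc : S ⊆ c.source) :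
    ∃ C : ℝ, 0 ≤ C ∧ ∀ u : M → ℝ, IsSmooth u → Function.support u ⊆ S →
      (∫ y, chartExtend c u y ^ 2 ≤ C * ∫ x, u x ^ 2 ∂vol g) ∧
      (∫ y, gradNormSq (chartExtend c u) y ≤ C * ∫ x, gradInner g u u x ∂vol g) ∧
      (∫ x, u x ^ 2 ∂vol g ≤ C * ∫ y, chartExtend c u y ^ 2) := by
  have hK : IsCompact (c '' S) := isCompact_chart_image hS hSc
  have hKt : c '' S ⊆ c.target := chart_image_subset_target hSc
  have hρ : ContinuousOn (sqrtDet g c) (c '' S) := (contDiffOn_sqrtDet g hc).continuousOn.mono hKt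
  have hρpos : ∀ y ∈ c '' S, 0 < sqrtDet g c y := fun y hy => sqrtDet_pos g hc (hKt hy)
  have htr : ContinuousOn (fun y => (lowerG g c y).trace) (c '' S) :=
    continuousOn_finsetSum _ fun i _ => (contDiffOn_lowerG g hc i i).continuousOn.mono hKt
  obtain ⟨C₁, hC₁⟩ := hK.exists_bound_of_continuousOn hρ
  obtain ⟨C₂, hC₂⟩ := hK.exists_bound_of_continuousOn (hρ.inv₀ fun y hy => (hρpos y hy).ne')
  obtain ⟨C₃, hC₃⟩ := hK.exists_bound_of_continuousOn
    ((hρ.inv₀ fun y hy => (hρpos y hy).ne').mul htr)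
  set C := max 0 (max C₁ (max C₂ C₃))
  have hC0 : 0 ≤ C := le_max_left _ _
  have hb₁ : ∀ y ∈ c '' S, sqrtDet g c y ≤ C := fun y hy =>
    (le_abs_self _).trans ((hC₁ y hy).trans (by simp [C]))
  have hb₂ : ∀ y ∈ c '' S, 1 ≤ C * sqrtDet g c y := fun y hy => by
    rw [← div_le_iff₀ (hρpos y hy), one_div]
    exact (le_abs_self _).trans ((hC₂ y hy).trans (by simp [C]))
  have hb₃ : ∀ y ∈ c '' S, (lowerG g c y).trace ≤ C * sqrtDet g c y := fun y hy => by
    rw [← div_le_iff₀ (hρpos y hy), div_eq_inv_mul]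
    exact (le_abs_self _).trans ((hC₃ y hy).trans (by simp [C]))
  have hsymm : ContinuousOn c.symm (c '' S) := c.continuousOn_symm.mono hKt
  refine ⟨C, hC0, fun u hu hus => ?_⟩
  have hsm := hu.contDiff_chartExtend hc hS hSc hus
  have hsupp : Function.support (chartExtend c u) ⊆ c '' S := support_chartExtend hus
  have hI : ∀ {h : E3 → ℝ}, ContinuousOn h (c '' S) → IntegrableOn h (c '' S) := fun hh =>
    hh.integrableOn_compact hK
  have hext : ∫ y, chartExtend c u y ^ 2 = ∫ y in c '' S, u (c.symm y) ^ 2 := by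
    rw [← setIntegral_eq_integral_of_forall_compl_eq_zero (s := c '' S) fun y hy => by
      rw [Function.notMem_support.1 fun h => hy (hsupp h), zero_pow two_ne_zero]]
    refine setIntegral_congr_fun hK.measurableSet fun y hy => ?_
    rw [chartExtend_of_mem c u (hKt hy)]
  have hu2 : Continuous fun x => u x ^ 2 := hu.continuous.pow 2
  have hu2c : ContinuousOn (fun y => u (c.symm y) ^ 2) (c '' S) := hu2.comp_continuousOn hsymm
  have hint : ∫ x, u x ^ 2 ∂vol g = ∫ y in c '' S, sqrtDet g c y * u (c.symm y) ^ 2 := by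
    rw [← setIntegral_chart g hc hS hSc hu2, setIntegral_eq_integral_of_forall_compl_eq_zero]
    intro x hx
    rw [Function.notMem_support.1 fun h => hx (hus h), zero_pow two_ne_zero]
  refine ⟨?_, ?_, ?_⟩
  · rw [hext, hint, ← integral_const_mul]
    refine setIntegral_mono_on (hI hu2c) (hI (continuousOn_const.mul (hρ.mul hu2c)))
      hK.measurableSet fun y hy => ?_
    nlinarith [hb₂ y hy, sq_nonneg (u (c.symm y))]
  · have hGc := continuous_gradInner g hu hu
    have h1 : ∫ x in S, gradInner g u u x ∂vol g ≤ ∫ x, gradInner g u u x ∂vol g :=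
      setIntegral_le_integral (integrable_of_continuous g hGc)
        (Eventually.of_forall fun x => gradInner_self_nonneg g u x)
    refine le_trans ?_ (mul_le_mul_of_nonneg_left h1 hC0)
    rw [setIntegral_chart g hc hS hSc hGc, ← integral_const_mul,
      ← setIntegral_eq_integral_of_forall_compl_eq_zero (s := c '' S) fun y hy => by
        simp [gradNormSq, pd_eq_zero_of_notMem hK.isClosed hsupp hy]]
    refine setIntegral_mono_on (hI (continuous_gradNormSq hsm).continuousOn)
      (hI (continuousOn_const.mul (hρ.mul (hGc.comp_continuousOn hsymm)))) hK.measurableSet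
      fun y hy => ?_
    refine (gradNormSq_le_trace_mul g hc u (hKt hy)).trans ?_
    rw [← mul_assoc, gradInner_eq_coord g hu hu hc (c.map_target (hKt hy)), c.right_inv (hKt hy)]
    refine mul_le_mul_of_nonneg_right (hb₃ y hy) ?_
    rw [coordGradInner_eq_dotProduct]
    exact (upperG_posDef g hc (hKt hy)).posSemidef.dotProduct_mulVec_nonneg _
  · rw [hext, hint, ← integral_const_mul]
    refine setIntegral_mono_on (hI (hρ.mul hu2c)) (hI (continuousOn_const.mul hu2c))
      hK.measurableSet fun y hy => ?_
    exact mul_le_mul_of_nonneg_right (hb₁ y hy) (sq_nonneg _)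

end ChartComparison

/-! ### Rellich's theorem on the manifold -/

section ManifoldCompactness

variable {M : Type*} [TopologicalSpace M] [ChartedSpace E3 M] [IsManifold (𝓡 3) ∞ M]
  [CompactSpace M] [T2Space M] [MeasurableSpace M] [BorelSpace M]

/-- Rellich's theorem on a compact Riemannian 3-manifold, for smooth functions. -/
theorem exists_subseq_cauchy (g : Metric M) {v : ℕ → M → ℝ} (hv : ∀ n, IsSmooth (v n)) {B : ℝ}
    (hB : ∀ n, ∫ x, v n x ^ 2 ∂vol g ≤ B) (hB' : ∀ n, ∫ x, gradInner g (v n) (v n) x ∂vol g ≤ B) :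
    ∃ φ : ℕ → ℕ, StrictMono φ ∧
      Tendsto (fun p : ℕ × ℕ => ∫ x, (v (φ p.1) x - v (φ p.2) x) ^ 2 ∂vol g) atTop (𝓝 0) := by
  obtain ⟨t, χ, hχ, hsupp, hone⟩ := exists_finite_partition M
  have hcmp := fun i => exists_chart_comparison g (chart_mem_atlas E3 i)
    (isClosed_tsupport (χ i)) (hsupp i)
  choose C hC0 hC using hcmp
  have hsub : ∀ i (w : M → ℝ), Function.support (χ i * w) ⊆ tsupport (χ i) := fun i w =>
    (Function.support_mul_subset_left _ _).trans subset_closure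
  have hbd : ∀ i, ∃ D : ℝ, ∀ x, χ i x ^ 2 ≤ D ∧ gradInner g (χ i) (χ i) x ≤ D := by
    intro i
    obtain ⟨D₁, hD₁⟩ := isCompact_univ.exists_bound_of_continuousOn
      ((hχ i).continuous.pow 2).continuousOn
    obtain ⟨D₂, hD₂⟩ := isCompact_univ.exists_bound_of_continuousOn
      (continuous_gradInner g (hχ i) (hχ i)).continuousOn
    exact ⟨max D₁ D₂, fun x =>
      ⟨(le_abs_self _).trans ((hD₁ x trivial).trans (le_max_left _ _)),
        (le_abs_self _).trans ((hD₂ x trivial).trans (le_max_right _ _))⟩⟩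
  choose D hD using hbd
  have hv2 : ∀ n, Integrable (fun x => v n x ^ 2) (vol g) := fun n =>
    integrable_of_continuous g ((hv n).continuous.pow 2)
  have hvg : ∀ n, Integrable (gradInner g (v n) (v n)) (vol g) := fun n =>
    integrable_of_continuous g (continuous_gradInner g (hv n) (hv n))
  have hsm : ∀ i n, IsSmooth (χ i * v n) := fun i n => (hχ i).mul (hv n)
  rcases isEmpty_or_nonempty M with hM | ⟨⟨x₀⟩⟩
  · refine ⟨id, strictMono_id, ?_⟩
    have : vol g = 0 := Measure.eq_zero_of_isEmpty _
    simp [this]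
  have hD0 : ∀ i, 0 ≤ D i := fun i => (sq_nonneg _).trans (hD i x₀).1
  have hb1 : ∀ i n, ∫ x, (χ i * v n) x ^ 2 ∂vol g ≤ D i * B := by
    intro i n
    refine le_trans ?_ (mul_le_mul_of_nonneg_left (hB n) (hD0 i))
    rw [← integral_const_mul]
    refine integral_mono (integrable_of_continuous g ((hsm i n).continuous.pow 2))
      ((hv2 n).const_mul _) fun x => ?_
    simp only [Pi.mul_apply, mul_pow]
    exact mul_le_mul_of_nonneg_right (hD i x).1 (sq_nonneg _)
  -- The product rule bounds the gradient of the localized function by the gradient and the value of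
  -- `v n`, which is why both bounds are assumed.
  have hb2 : ∀ i n, ∫ x, gradInner g (χ i * v n) (χ i * v n) x ∂vol g ≤ 4 * (D i * B) := by
    intro i n
    have h1 : ∫ x, gradInner g (χ i * v n) (χ i * v n) x ∂vol g ≤
        ∫ x, (2 * D i * gradInner g (v n) (v n) x + 2 * D i * v n x ^ 2) ∂vol g := by
      refine integral_mono
        (integrable_of_continuous g (continuous_gradInner g (hsm i n) (hsm i n)))
        (((hvg n).const_mul _).add ((hv2 n).const_mul _)) fun x => ?_
      have h2 := gradInner_mul_self_le g (hχ i) (hv n) x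
      have h3 := mul_le_mul_of_nonneg_right (hD i x).1 (gradInner_self_nonneg g (v n) x)
      have h4 := mul_le_mul_of_nonneg_left (hD i x).2 (sq_nonneg (v n x))
      linarith
    rw [integral_add ((hvg n).const_mul _) ((hv2 n).const_mul _), integral_const_mul,
      integral_const_mul] at h1
    have h5 := mul_le_mul_of_nonneg_left (hB n) (hD0 i)
    have h6 := mul_le_mul_of_nonneg_left (hB' n) (hD0 i)
    linarith
  have hB0 : 0 ≤ B := (integral_nonneg fun x => sq_nonneg (v 0 x)).trans (hB 0)
  obtain ⟨φ, hφ, hlim⟩ := exists_common_subseq t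
    (f := fun i n => chartExtend (chartAt E3 i) (χ i * v n))
    (fun i n => (hsm i n).contDiff_chartExtend (chart_mem_atlas E3 i) (isClosed_tsupport (χ i))
      (hsupp i) (hsub i _))
    (fun i => isCompact_chart_image (isClosed_tsupport (χ i)) (hsupp i))
    (fun i n => support_chartExtend (hsub i _)) (B := fun i => C i * (4 * (D i * B)))
    (fun i n => ((hC i _ (hsm i n) (hsub i _)).1).trans (mul_le_mul_of_nonneg_left
      ((hb1 i n).trans (by nlinarith [mul_nonneg (hD0 i) hB0])) (hC0 i)))
    (fun i n => ((hC i _ (hsm i n) (hsub i _)).2.1).trans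
      (mul_le_mul_of_nonneg_left (hb2 i n) (hC0 i)))
  refine ⟨φ, hφ, ?_⟩
  -- A difference `d` is the sum of its localizations `χ i * d`, so `d² ≤ card t · ∑ (χ i * d)²`,
  -- and each term is compared with its Euclidean counterpart.
  have hup : Tendsto (fun p : ℕ × ℕ => (t.card : ℝ) * ∑ i ∈ t, C i *
      ∫ y, (chartExtend (chartAt E3 i) (χ i * v (φ p.1)) y -
        chartExtend (chartAt E3 i) (χ i * v (φ p.2)) y) ^ 2) atTop (𝓝 0) := by
    have h1 := (tendsto_finsetSum t fun i hi => (hlim i hi).const_mul (C i)).const_mul (t.card : ℝ)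
    simpa using h1
  refine squeeze_zero (fun p => integral_nonneg fun x => sq_nonneg _) (fun p => ?_) hup
  set d : M → ℝ := v (φ p.1) - v (φ p.2)
  have hd : IsSmooth d := (hv _).sub (hv _)
  have hdi : ∀ i, Integrable (fun x => (χ i * d) x ^ 2) (vol g) := fun i =>
    integrable_of_continuous g (((hχ i).mul hd).continuous.pow 2)
  have h1 : ∫ x, d x ^ 2 ∂vol g ≤ ∫ x, (t.card : ℝ) * ∑ i ∈ t, (χ i * d) x ^ 2 ∂vol g := by
    refine integral_mono (integrable_of_continuous g (hd.continuous.pow 2))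
      ((integrable_finsetSum t fun i _ => hdi i).const_mul _) fun x => ?_
    have h2 : d x = ∑ i ∈ t, (χ i * d) x := by
      simp only [Pi.mul_apply, ← Finset.sum_mul, hone, one_mul]
    beta_reduce
    conv_lhs => rw [h2]
    exact sq_sum_le_card_mul_sum_sq
  rw [integral_const_mul, integral_finsetSum t fun i _ => hdi i] at h1
  refine h1.trans (mul_le_mul_of_nonneg_left (Finset.sum_le_sum fun i _ => ?_) (by positivity))
  refine ((hC i _ ((hχ i).mul hd) (hsub i _)).2.2).trans (le_of_eq ?_)
  congr 2
  ext y
  by_cases hy : y ∈ (chartAt E3 i).target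
  · simp only [chartExtend_of_mem _ _ hy, d, Pi.mul_apply, Pi.sub_apply]
    ring
  · simp [chartExtend, hy]

end ManifoldCompactness

/-! ### Limits in `L²` -/

section SquareIntegrableLimits

variable {α : Type*} [MeasurableSpace α] {μ : Measure α}

lemma tendsto_toLp_of_eLpNorm {u : α → ℝ} {w : ℕ → α → ℝ} (hu : MemLp u 2 μ)
    (hw : ∀ n, MemLp (w n) 2 μ)
    (h : Tendsto (fun n => eLpNorm (u - w n) 2 μ) atTop (𝓝 0)) :
    Tendsto (fun n => (hw n).toLp (w n)) atTop (𝓝 (hu.toLp u)) := by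
  rw [Lp.tendsto_Lp_iff_tendsto_eLpNorm'']
  refine h.congr fun n => ?_
  exact eLpNorm_sub_comm _ _ _ _

lemma inner_toLp {u h : α → ℝ} (hu : MemLp u 2 μ) (hh : MemLp h 2 μ) :
    inner ℝ (hu.toLp u) (hh.toLp h) = ∫ x, u x * h x ∂μ := by
  rw [L2.inner_def]
  refine integral_congr_ae ?_
  filter_upwards [hu.coeFn_toLp, hh.coeFn_toLp] with x h1 h2
  rw [h1, h2]
  simp [mul_comm]

lemma tendsto_integral_mul_of_eLpNorm {u h : α → ℝ} {w : ℕ → α → ℝ} (hu : MemLp u 2 μ)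
    (hw : ∀ n, MemLp (w n) 2 μ) (hh : MemLp h 2 μ)
    (hlim : Tendsto (fun n => eLpNorm (u - w n) 2 μ) atTop (𝓝 0)) :
    Tendsto (fun n => ∫ x, w n x * h x ∂μ) atTop (𝓝 (∫ x, u x * h x ∂μ)) := by
  have h1 := (tendsto_toLp_of_eLpNorm hu hw hlim).inner (𝕜 := ℝ)
    (tendsto_const_nhds (x := hh.toLp h))
  simpa only [inner_toLp] using h1

lemma integral_sq_pos {u : α → ℝ} (hu : MemLp u 2 μ) (h0 : ¬ u =ᵐ[μ] 0) :
    0 < ∫ x, u x ^ 2 ∂μ := by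
  refine lt_of_le_of_ne (integral_nonneg fun x => sq_nonneg _) fun h => h0 ?_
  have h1 := (integral_eq_zero_iff_of_nonneg (fun x => sq_nonneg _) hu.integrable_sq).1 h.symm
  filter_upwards [h1] with x hx
  exact pow_eq_zero_iff two_ne_zero |>.1 hx

lemma exists_limit_of_cauchy {w : ℕ → α → ℝ} (hw : ∀ n, MemLp (w n) 2 μ)
    (hc : Tendsto (fun p : ℕ × ℕ => ∫ x, (w p.1 x - w p.2 x) ^ 2 ∂μ) atTop (𝓝 0)) :
    ∃ u : α → ℝ, MemLp u 2 μ ∧ Tendsto (fun n => eLpNorm (u - w n) 2 μ) atTop (𝓝 0) := by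
  have hcau : CauchySeq fun n => (hw n).toLp (w n) := by
    rw [cauchySeq_iff_tendsto_dist_atTop_0]
    have h1 := hc.sqrt
    rw [Real.sqrt_zero] at h1
    refine h1.congr fun p => ?_
    rw [dist_eq_norm, ← MemLp.toLp_sub, Lp.norm_toLp, eLpNorm_two_eq ((hw p.1).sub (hw p.2)),
      ENNReal.toReal_ofReal (Real.sqrt_nonneg _)]
    rfl
  obtain ⟨U, hU⟩ := cauchySeq_tendsto_of_complete hcau
  refine ⟨U, Lp.memLp U, ?_⟩
  rw [Lp.tendsto_Lp_iff_tendsto_eLpNorm'] at hU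
  refine hU.congr fun n => ?_
  rw [eLpNorm_sub_comm]
  refine eLpNorm_congr_ae ?_
  filter_upwards [(hw n).coeFn_toLp] with x hx
  simp [hx]

end SquareIntegrableLimits

/-! ### The energy form and its minimizers -/

section Energy

variable {M : Type*} [TopologicalSpace M] [ChartedSpace E3 M] [IsManifold (𝓡 3) ∞ M]

lemma gradInner_add_smul_self (g : Metric M) {v w : M → ℝ} (hv : IsSmooth v) (hw : IsSmooth w)
    (t : ℝ) (x : M) : gradInner g (v + t • w) (v + t • w) x =
      gradInner g v v x + 2 * t * gradInner g v w x + t ^ 2 * gradInner g w w x := by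
  have h : ∀ z : M → ℝ, gradInner g (v + t • w) z x =
      gradInner g v z x + t * gradInner g w z x := fun z => by
    rw [gradInner_add_left g z hv (hw.smul t), gradInner_smul_left g z hw]
  rw [h, gradInner_comm g v, gradInner_comm g w, h, h, gradInner_comm g w v]
  ring

variable [MeasurableSpace M]

/-- The quadratic form `∫ (⟨∇v, ∇w⟩ + q v w)` of the operator `-Δ + q`. -/
def energy (g : Metric M) (q v w : M → ℝ) : ℝ :=
  ∫ x, (gradInner g v w x + q x * (v x * w x)) ∂vol g

variable [BorelSpace M] [CompactSpace M]

lemma IsSmooth.memLp (g : Metric M) {v : M → ℝ} (hv : IsSmooth v) : MemLp v 2 (vol g) := by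
  have := isFiniteMeasure_vol g
  exact hv.continuous.memLp_of_hasCompactSupport (HasCompactSupport.of_compactSpace v)

lemma energy_eq (g : Metric M) {q v w : M → ℝ} (hq : Continuous q) (hv : IsSmooth v)
    (hw : IsSmooth w) : energy g q v w =
      ∫ x, gradInner g v w x ∂vol g + ∫ x, q x * (v x * w x) ∂vol g :=
  integral_add (integrable_of_continuous g (continuous_gradInner g hv hw))
    (integrable_of_continuous g (hq.mul (hv.continuous.mul hw.continuous)))

lemma energy_add_smul_self (g : Metric M) {q v w : M → ℝ} (hq : Continuous q) (hv : IsSmooth v)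
    (hw : IsSmooth w) (t : ℝ) : energy g q (v + t • w) (v + t • w) =
      energy g q v v + 2 * t * energy g q v w + t ^ 2 * energy g q w w := by
  have hi : ∀ {a b : M → ℝ}, IsSmooth a → IsSmooth b →
      Integrable (fun x => gradInner g a b x + q x * (a x * b x)) (vol g) := fun ha hb =>
    integrable_of_continuous g ((continuous_gradInner g ha hb).add
      (hq.mul (ha.continuous.mul hb.continuous)))
  have h1 : Integrable (fun x => 2 * t * (gradInner g v w x + q x * (v x * w x))) (vol g) :=
    (hi hv hw).const_mul _
  have h2 : Integrable (fun x => t ^ 2 * (gradInner g w w x + q x * (w x * w x))) (vol g) :=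
    (hi hw hw).const_mul _
  have h3 : Integrable (fun x => gradInner g v v x + q x * (v x * v x) +
      2 * t * (gradInner g v w x + q x * (v x * w x))) (vol g) := (hi hv hv).add h1
  simp only [energy]
  rw [← integral_const_mul, ← integral_const_mul, ← integral_add (hi hv hv) h1,
    ← integral_add h3 h2]
  congr 1
  ext x
  rw [gradInner_add_smul_self g hv hw]
  simp only [Pi.add_apply, Pi.smul_apply, smul_eq_mul]
  ring

lemma energy_sub_const (g : Metric M) {q v w : M → ℝ} (hq : Continuous q) (hv : IsSmooth v)
    (hw : IsSmooth w) (k : ℝ) : energy g (fun x => q x - k) v w =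
      energy g q v w - k * ∫ x, v x * w x ∂vol g := by
  have hqk : Continuous fun x => q x - k := hq.sub continuous_const
  rw [energy_eq g hqk hv hw, energy_eq g hq hv hw, add_sub_assoc,
    ← integral_const_mul, ← integral_sub]
  · simp only [sub_mul]
  · exact integrable_of_continuous g (hq.mul (hv.continuous.mul hw.continuous))
  · exact integrable_of_continuous g (continuous_const.mul (hv.continuous.mul hw.continuous))

/-- Cauchy-Schwarz for a nonnegative form: the energy of `v + t • w` is a nonnegative quadratic
polynomial in `t`, so its discriminant is not positive. -/
lemma sq_energy_le (g : Metric M) {q v w : M → ℝ} (hq : Continuous q) (hv : IsSmooth v)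
    (hw : IsSmooth w) (hpos : ∀ u, IsSmooth u → 0 ≤ energy g q u u) :
    energy g q v w ^ 2 ≤ energy g q v v * energy g q w w := by
  have h := discrim_le_zero (a := energy g q w w) (b := 2 * energy g q v w) (c := energy g q v v)
    fun t => by
      have h1 := hpos _ (hv.add (hw.smul t))
      rw [energy_add_smul_self g hq hv hw] at h1
      linarith
  rw [discrim] at h
  linarith

/-- Coercivity: a bounded potential costs at most a multiple of the `L²` norm, so bounds on energy
and `L²` norm give an `H¹` bound. -/
lemma integral_gradInner_self_le_energy_add (g : Metric M) {q v : M → ℝ} (hq : Continuous q) {Q : ℝ}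
    (hQ : ∀ x, |q x| ≤ Q) (hv : IsSmooth v) :
    ∫ x, gradInner g v v x ∂vol g ≤ energy g q v v + Q * ∫ x, v x ^ 2 ∂vol g := by
  have h1 : -(Q * ∫ x, v x ^ 2 ∂vol g) ≤ ∫ x, q x * (v x * v x) ∂vol g := by
    rw [← integral_const_mul, ← integral_neg]
    refine integral_mono (integrable_of_continuous g
      (continuous_const.mul (hv.continuous.pow 2)).neg)
      (integrable_of_continuous g (hq.mul (hv.continuous.mul hv.continuous))) fun x => ?_
    have := neg_le_of_abs_le (hQ x)
    nlinarith [mul_self_nonneg (v x)]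
  rw [energy_eq g hq hv hv]
  linarith

variable [T2Space M]

lemma integral_mul_neg_laplacian_add (g : Metric M) {q v w : M → ℝ} (hq : Continuous q)
    (hv : IsSmooth v) (hw : IsSmooth w) :
    ∫ x, v x * (-laplacian g w x + q x * w x) ∂vol g = energy g q v w := by
  rw [energy_eq g hq hv hw, ← neg_neg (∫ x, gradInner g v w x ∂vol g), ← green g hv hw,
    ← integral_neg, ← integral_add]
  · congr 1
    ext x
    ring
  · exact integrable_of_continuous g (hv.continuous.mul (continuous_laplacian g hw)).neg
  · exact integrable_of_continuous g (hq.mul (hv.continuous.mul hw.continuous))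

/-- `u` is a weak eigenfunction of `-Δ + q` with eigenvalue `lam`. -/
def IsWeakEigenfunction (g : Metric M) (q u : M → ℝ) (lam : ℝ) : Prop :=
  MemH1 g u ∧ ¬ u =ᵐ[vol g] 0 ∧ ∀ ψ : M → ℝ, IsSmooth ψ →
    ∫ x, u x * (-laplacian g ψ x + q x * ψ x) ∂vol g = lam * ∫ x, u x * ψ x ∂vol g

lemma memLp_neg_laplacian_add (g : Metric M) {q w : M → ℝ} (hq : Continuous q)
    (hw : IsSmooth w) : MemLp (fun x => -laplacian g w x + q x * w x) 2 (vol g) := by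
  have := isFiniteMeasure_vol g
  exact ((continuous_laplacian g hw).neg.add
    (hq.mul hw.continuous)).memLp_of_hasCompactSupport (HasCompactSupport.of_compactSpace _)

/-- The operator `-Δ + q` has an eigenvalue which is at most the mean of `q`. -/
theorem exists_weakEigenfunction [Nonempty M] (g : Metric M) {q : M → ℝ} (hq : Continuous q) :
    ∃ (lam : ℝ) (u : M → ℝ), IsWeakEigenfunction g q u lam ∧
      lam * (vol g).real Set.univ ≤ ∫ x, q x ∂vol g := by
  have := ChartedSpace.secondCountable_of_sigmaCompact E3 M
  have := isFiniteMeasure_vol g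
  have := isOpenPosMeasure_vol g
  set V := (vol g).real Set.univ
  have hV : 0 < V := ENNReal.toReal_pos (isOpen_univ.measure_ne_zero _ Set.univ_nonempty)
    (measure_ne_top _ _)
  obtain ⟨Q, hQ'⟩ := isCompact_univ.exists_bound_of_continuousOn hq.continuousOn
  have hQ : ∀ x, |q x| ≤ Q := fun x => hQ' x trivial
  have hlow : ∀ v, IsSmooth v → -(Q * ∫ x, v x ^ 2 ∂vol g) ≤ energy g q v v := by
    intro v hv
    have h1 := integral_gradInner_self_le_energy_add g hq hQ hv
    have h2 : 0 ≤ ∫ x, gradInner g v v x ∂vol g :=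
      integral_nonneg fun x => gradInner_self_nonneg g v x
    linarith
  set S : Set ℝ := {e | ∃ v : M → ℝ, IsSmooth v ∧ ∫ x, v x ^ 2 ∂vol g = 1 ∧ energy g q v v = e}
  have hSb : BddBelow S := by
    refine ⟨-Q, ?_⟩
    rintro _ ⟨v, hv, h1, rfl⟩
    have := hlow v hv
    rwa [h1, mul_one] at this
  -- The constant function of unit `L²` norm; its energy is the mean of `q`.
  have hconst : (∫ x, q x ∂vol g) / V ∈ S := by
    refine ⟨fun _ => (√V)⁻¹, isSmooth_const _, ?_, ?_⟩
    · simp only [inv_pow, Real.sq_sqrt hV.le, integral_const, smul_eq_mul]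
      exact mul_inv_cancel₀ hV.ne'
    · have h1 : (√V)⁻¹ * (√V)⁻¹ = V⁻¹ := by
        rw [← mul_inv, Real.mul_self_sqrt hV.le]
      simp only [energy, gradInner_const_left, zero_add, h1]
      rw [integral_mul_const, div_eq_mul_inv]
  set lam := sInf S
  -- The definition of the infimum, extended from unit vectors to all smooth functions by
  -- homogeneity. A function of zero `L²` norm cannot be normalized and is covered by the lower
  -- bound on the energy.
  have hlam : ∀ v, IsSmooth v → 0 ≤ energy g (fun x => q x - lam) v v := by
    intro v hv
    rw [energy_sub_const g hq hv hv]
    have hsq : ∀ a : M → ℝ, ∫ x, a x * a x ∂vol g = ∫ x, a x ^ 2 ∂vol g := fun a => by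
      simp only [pow_two]
    rw [hsq]
    have hnn : 0 ≤ ∫ x, v x ^ 2 ∂vol g := integral_nonneg fun x => sq_nonneg _
    rcases hnn.eq_or_lt with h0 | hpos
    · have := hlow v hv
      rw [← h0] at this ⊢
      linarith
    · set N := ∫ x, v x ^ 2 ∂vol g
      have hmem : N⁻¹ * energy g q v v ∈ S := by
        refine ⟨(√N)⁻¹ • v, hv.smul _, ?_, ?_⟩
        · simp only [Pi.smul_apply, smul_eq_mul, mul_pow, inv_pow, Real.sq_sqrt hpos.le]
          rw [integral_const_mul]
          exact inv_mul_cancel₀ hpos.ne'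
        -- Homogeneity of degree two, read off from the expansion at `v = 0`.
        · have h1 := energy_add_smul_self g hq (isSmooth_const 0) hv (√N)⁻¹
          have h2 : (fun _ : M => (0 : ℝ)) + (√N)⁻¹ • v = (√N)⁻¹ • v := by
            ext x
            simp
          rw [h2] at h1
          rw [h1, inv_pow, Real.sq_sqrt hpos.le]
          simp [energy, gradInner_const_left]
      have h1 := csInf_le hSb hmem
      have h2 : lam * N ≤ energy g q v v := by
        rw [← le_div_iff₀ hpos, div_eq_inv_mul]
        exact h1
      linarith
  obtain ⟨e, _, he, heS⟩ := exists_seq_tendsto_sInf ⟨_, hconst⟩ hSb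
  choose v hv hvn hve using heS
  obtain ⟨A, hA⟩ := he.bddAbove_range
  have hgb : ∀ n, ∫ x, gradInner g (v n) (v n) x ∂vol g ≤ max 1 (A + Q) := by
    intro n
    have h1 := integral_gradInner_self_le_energy_add g hq hQ (hv n)
    rw [hvn, hve] at h1
    have h2 : e n ≤ A := hA ⟨n, rfl⟩
    exact le_max_of_le_right (by linarith)
  obtain ⟨φ, hφ, hcau⟩ := exists_subseq_cauchy g hv
    (fun n => (hvn n).trans_le (le_max_left 1 (A + Q))) hgb
  set w : ℕ → M → ℝ := fun n => v (φ n)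
  have hw : ∀ n, IsSmooth (w n) := fun n => hv _
  have hwL : ∀ n, MemLp (w n) 2 (vol g) := fun n => (hw n).memLp g
  obtain ⟨u, huL, hu⟩ := exists_limit_of_cauchy hwL hcau
  -- Along the minimizing sequence the shifted energy tends to its infimum `0`.
  have hF : Tendsto (fun n => energy g (fun x => q x - lam) (w n) (w n)) atTop (𝓝 0) := by
    have h1 := (he.comp hφ.tendsto_atTop).sub_const lam
    rw [sub_self] at h1
    refine h1.congr fun n => ?_
    rw [energy_sub_const g hq (hw n) (hw n)]
    have h2 : ∫ x, w n x * w n x ∂vol g = 1 := by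
      rw [← hvn (φ n)]
      simp only [w, pow_two]
    rw [h2, mul_one, Function.comp_apply, ← hve]
  have hql : Continuous fun x => q x - lam := hq.sub continuous_const
  refine ⟨lam, u, ⟨⟨huL, w, hw, hu, ?_⟩, ?_, ?_⟩, ?_⟩
  · have hQl : ∀ x, |q x - lam| ≤ Q + |lam| := fun x => (abs_sub _ _).trans (by linarith [hQ x])
    have hF1 : Tendsto (fun p : ℕ × ℕ => energy g (fun x => q x - lam) (w p.1) (w p.1)) atTop
        (𝓝 0) := by
      rw [← prod_atTop_atTop_eq]
      exact hF.comp tendsto_fst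
    have hF2 : Tendsto (fun p : ℕ × ℕ => energy g (fun x => q x - lam) (w p.2) (w p.2)) atTop
        (𝓝 0) := by
      rw [← prod_atTop_atTop_eq]
      exact hF.comp tendsto_snd
    have hup := ((hF1.const_mul 2).add (hF2.const_mul 2)).add (hcau.const_mul (Q + |lam|))
    simp only [mul_zero, add_zero] at hup
    refine squeeze_zero (fun p => integral_nonneg fun x => gradInner_self_nonneg g _ x)
      (fun p => ?_) hup
    -- Parallelogram identity for the shifted energy: the sum `w p.1 + w p.2` has nonnegative
    -- energy, so the energy of the difference is at most twice the sum of two energies tending to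
    -- `0`. Coercivity and `L²` convergence then control the gradient of the difference.
    have h1 := integral_gradInner_self_le_energy_add g hql hQl ((hw p.1).sub (hw p.2))
    have h2 := energy_add_smul_self g hql (hw p.1) (hw p.2) (-1)
    have h3 := energy_add_smul_self g hql (hw p.1) (hw p.2) 1
    have h4 := hlam _ ((hw p.1).add ((hw p.2).smul 1))
    have h5 : w p.1 + (-1 : ℝ) • w p.2 = w p.1 - w p.2 := by
      rw [neg_one_smul, sub_eq_add_neg]
    rw [h5] at h2
    have h6 : ∫ x, (w p.1 - w p.2) x ^ 2 ∂vol g =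
        ∫ x, (v (φ p.1) x - v (φ p.2) x) ^ 2 ∂vol g := rfl
    rw [h6] at h1
    have h7 : ∫ x, gradSq g (w p.1 - w p.2) x ∂vol g =
        ∫ x, gradInner g (w p.1 - w p.2) (w p.1 - w p.2) x ∂vol g := rfl
    linarith
  -- The unit `L²` norm survives strong convergence.
  · intro h0
    have h1 := (tendsto_toLp_of_eLpNorm huL hwL hu).norm
    have h2 : ∀ n, ‖(hwL n).toLp (w n)‖ = 1 := fun n => by
      rw [Lp.norm_toLp, eLpNorm_two_eq (hwL n)]
      simp [w, hvn]
    have h3 : huL.toLp u = 0 := (huL.toLp_congr MemLp.zero h0).trans (MemLp.toLp_zero _)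
    simp only [h2, h3, norm_zero] at h1
    exact one_ne_zero (tendsto_nhds_unique tendsto_const_nhds h1)
  · intro ψ hψ
    have h1 := tendsto_integral_mul_of_eLpNorm huL hwL (memLp_neg_laplacian_add g hq hψ) hu
    have h2 := (tendsto_integral_mul_of_eLpNorm huL hwL (hψ.memLp g) hu).const_mul lam
    -- By Cauchy-Schwarz, a sequence whose shifted energy tends to `0` becomes orthogonal, for that
    -- form, to every fixed `ψ`. This is the weak equation in the limit.
    have h3 : Tendsto (fun n => energy g (fun x => q x - lam) (w n) ψ) atTop (𝓝 0) := by
      have h4 : Tendsto (fun n => √(energy g (fun x => q x - lam) (w n) (w n) *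
          energy g (fun x => q x - lam) ψ ψ)) atTop (𝓝 0) := by
        simpa using (hF.mul_const (energy g (fun x => q x - lam) ψ ψ)).sqrt
      refine squeeze_zero_norm (fun n => ?_) h4
      rw [Real.norm_eq_abs]
      exact Real.abs_le_sqrt (sq_energy_le g hql (hw n) hψ hlam)
    have h5 : Tendsto (fun n => energy g (fun x => q x - lam) (w n) ψ) atTop
        (𝓝 (∫ x, u x * (-laplacian g ψ x + q x * ψ x) ∂vol g - lam * ∫ x, u x * ψ x ∂vol g)) := by
      refine (h1.sub h2).congr fun n => ?_
      rw [integral_mul_neg_laplacian_add g hq (hw n) hψ, energy_sub_const g hq (hw n) hψ]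
    exact sub_eq_zero.1 (tendsto_nhds_unique h5 h3)
  · rw [← le_div_iff₀ hV]
    exact csInf_le hSb hconst

/-- An eigenvalue of `-Δ + k` is at least `k`, for a constant `k`. -/
theorem IsWeakEigenfunction.le_of_const {g : Metric M} {u : M → ℝ} {k lam : ℝ}
    (h : IsWeakEigenfunction g (fun _ => k) u lam) : k ≤ lam := by
  obtain ⟨⟨huL, v, hv, hlim, hgrad⟩, h0, heq⟩ := h
  have hvL : ∀ n, MemLp (v n) 2 (vol g) := fun n => (hv n).memLp g
  have hpos := integral_sq_pos huL h0
  -- The equation is tested with the approximating `v m`, and `u` is then replaced by the limit of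
  -- `v n`, so that Green's formula applies to smooth functions only.
  have hweak : ∀ m, Tendsto (fun n => ∫ x, gradInner g (v n) (v m) x ∂vol g) atTop
      (𝓝 ((lam - k) * ∫ x, v m x * u x ∂vol g)) := by
    intro m
    have h1 := tendsto_integral_mul_of_eLpNorm huL hvL
      (memLp_neg_laplacian_add g (continuous_const (y := k)) (hv m)) hlim
    have h2 := (tendsto_integral_mul_of_eLpNorm huL hvL (hvL m) hlim).const_mul k
    have h3 := h1.sub h2
    rw [heq _ (hv m), ← sub_mul] at h3
    simp only [mul_comm (v m _) (u _)]
    refine h3.congr fun n => ?_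
    rw [integral_mul_neg_laplacian_add g continuous_const (hv n) (hv m),
      energy_eq g continuous_const (hv n) (hv m), integral_const_mul, add_sub_cancel_right]
  -- From `2⟨∇vₙ, ∇vₘ⟩ ≥ -|∇(vₙ - vₘ)|²` and the Cauchy property of the gradients, the mixed
  -- Dirichlet integral is at least `-ε` for large indices. The limits are taken first in `n`, then
  -- in `m`.
  have hnear : ∀ ε > 0, -ε ≤ (lam - k) * ∫ x, u x ^ 2 ∂vol g := by
    intro ε hε
    obtain ⟨⟨a, b⟩, hab⟩ := eventually_atTop.1 (hgrad.eventually_lt_const hε)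
    have h1 : ∀ᶠ m in atTop, -ε ≤ (lam - k) * ∫ x, v m x * u x ∂vol g := by
      filter_upwards [eventually_ge_atTop b] with m hm
      refine ge_of_tendsto (hweak m) ?_
      filter_upwards [eventually_ge_atTop a] with n hn
      have h2 : ∫ x, gradSq g (v n - v m) x ∂vol g < ε := hab (n, m) ⟨hn, hm⟩
      have h3 : ∀ x, gradSq g (v n - v m) x =
          gradInner g (v n) (v n) x + 2 * (-1) * gradInner g (v n) (v m) x +
            (-1) ^ 2 * gradInner g (v m) (v m) x := by
        intro x
        rw [← gradInner_add_smul_self g (hv n) (hv m) (-1) x, neg_one_smul, ← sub_eq_add_neg,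
          gradSq_eq]
      have hc : ∀ i j, Continuous (gradInner g (v i) (v j)) := fun i j =>
        continuous_gradInner g (hv i) (hv j)
      have h4 : ∫ x, -gradSq g (v n - v m) x ∂vol g ≤
          ∫ x, 2 * gradInner g (v n) (v m) x ∂vol g := by
        refine integral_mono (integrable_of_continuous g
          (continuous_gradInner g ((hv n).sub (hv m)) ((hv n).sub (hv m))).neg)
          (integrable_of_continuous g (continuous_const.mul (hc n m))) fun x => ?_
        beta_reduce
        rw [h3]
        linarith [gradInner_self_nonneg g (v n) x, gradInner_self_nonneg g (v m) x]
      rw [integral_neg, integral_const_mul] at h4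
      linarith
    have h5 := (tendsto_integral_mul_of_eLpNorm huL hvL huL hlim).const_mul (lam - k)
    simp only [pow_two]
    exact ge_of_tendsto h5 h1
  have hnn : 0 ≤ (lam - k) * ∫ x, u x ^ 2 ∂vol g := by
    refine le_of_forall_pos_le_add fun ε hε => ?_
    linarith [hnear ε hε]
  linarith [nonneg_of_mul_nonneg_left hnn hpos]

end Energy

/-! ### The linearized operator of the data -/

namespace InitialData

variable {Λ : ℝ} {M : Type*} [TopologicalSpace M] [ChartedSpace E3 M] [IsManifold (𝓡 3) ∞ M]

lemma continuous_OmegaSq (D : InitialData Λ M) : Continuous D.OmegaSq :=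
  continuous_omegaSq D.g D.smooth_K

/-- The Hamiltonian constraint eliminates the scalar curvature: `(Ω² + 2Λ)/8 - 5Λ/4 + 7Ω²/8 = Ω² -
Λ`. -/
lemma linearized_one (D : InitialData Λ M) (ψ : M → ℝ) (x : M) :
    linearized Λ D.g D.K (fun _ => 1) ψ x = -laplacian D.g ψ x + (D.OmegaSq x - Λ) * ψ x := by
  rw [linearized, D.hamiltonian x, OmegaSq]
  ring

lemma isEigenvalue_iff [MeasurableSpace M] (D : InitialData Λ M) (lam : ℝ) :
    IsEigenvalue Λ D.g D.K (fun _ => 1) lam ↔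
      ∃ u, IsWeakEigenfunction D.g (fun x => D.OmegaSq x - Λ) u lam := by
  simp only [IsEigenvalue, IsWeakEigenfunction, D.linearized_one]

/-- On an empty manifold every function vanishes almost everywhere, so there is no eigenfunction. -/
lemma HasLowestEigenvalue.nonempty [MeasurableSpace M] {D : InitialData Λ M} {s : ℝ}
    (hs : D.HasLowestEigenvalue s) : Nonempty M := by
  obtain ⟨u, _, h0, _⟩ := hs.1
  by_contra h
  rw [not_nonempty_iff] at h
  exact h0 (Eventually.of_forall fun x => isEmptyElim x)

end InitialData

end MaximalData

end

/-! ### The three claims -/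

theorem proposition1 (Λ : ℝ) (hΛ : 0 < Λ)
    (M : Type*) [TopologicalSpace M] [T2Space M] [CompactSpace M]
    [ChartedSpace MaximalData.E3 M] [IsManifold (𝓡 3) ∞ M]
    [MeasurableSpace M] [BorelSpace M]
    (D : MaximalData.InitialData Λ M) (s : ℝ) (hs : D.HasLowestEigenvalue s) :
    (Λ + s) * D.volume ≤ ∫ x, D.OmegaSq x ∂MaximalData.vol D.g ∧
    ((∀ x, D.OmegaSq x ≤ Λ) → (¬ ∀ x, D.OmegaSq x = Λ) → D.StrictlyUnstable) ∧
    ((∀ x, D.OmegaSq x = 0) → s = -Λ) ∧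
    ((∀ x, D.OmegaSq x = Λ) → s = 0) := by
  have := ChartedSpace.secondCountable_of_sigmaCompact MaximalData.E3 M
  have := MaximalData.isFiniteMeasure_vol D.g
  have := MaximalData.isOpenPosMeasure_vol D.g
  have := hs.nonempty
  have hΩ := D.continuous_OmegaSq
  have hΩi := MaximalData.integrable_of_continuous D.g hΩ
  have hV : 0 < D.volume := ENNReal.toReal_pos (isOpen_univ.measure_ne_zero _ Set.univ_nonempty)
    (measure_ne_top _ _)
  have hmain : (Λ + s) * D.volume ≤ ∫ x, D.OmegaSq x ∂MaximalData.vol D.g := by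
    obtain ⟨lam, u, hu, hle⟩ :=
      MaximalData.exists_weakEigenfunction D.g (hΩ.sub (continuous_const (y := Λ)))
    have h1 : s ≤ lam := hs.2 ((D.isEigenvalue_iff lam).2 ⟨u, hu⟩)
    have h2 : (∫ x, (D.OmegaSq x - Λ) ∂MaximalData.vol D.g) =
        (∫ x, D.OmegaSq x ∂MaximalData.vol D.g) - Λ * D.volume := by
      rw [integral_sub hΩi (integrable_const _), integral_const, smul_eq_mul, mul_comm]
      rfl
    change lam * D.volume ≤ ∫ x, (D.OmegaSq x - Λ) ∂MaximalData.vol D.g at hle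
    rw [h2] at hle
    have h3 := mul_le_mul_of_nonneg_right h1 hV.le
    linarith
  -- Claim 1 gives the upper bound for `s`, and the nonnegativity of the Dirichlet form the lower
  -- one; `k = 0` and `k = Λ` are the two cases of claim 3.
  have hconst : ∀ k, (∀ x, D.OmegaSq x = k) → s = k - Λ := by
    intro k hk
    obtain ⟨u, hu⟩ := (D.isEigenvalue_iff s).1 hs.1
    simp only [hk] at hu hmain
    have h1 := hu.le_of_const
    rw [integral_const, smul_eq_mul, mul_comm _ k] at hmain
    have h2 : Λ + s ≤ k := le_of_mul_le_mul_right hmain hV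
    linarith
  refine ⟨hmain, fun hle hne => ⟨s, hs, ?_⟩, fun h => by simpa using hconst 0 h,
    fun h => by simpa using hconst Λ h⟩
  obtain ⟨x₀, hx₀⟩ := not_forall.1 hne
  -- A continuous nonnegative function that is positive somewhere has positive integral, because
  -- nonempty open sets have positive volume.
  have h1 : 0 < ∫ x, (Λ - D.OmegaSq x) ∂MaximalData.vol D.g := by
    refine (continuous_const.sub hΩ).integral_pos_of_hasCompactSupport_nonneg_nonzero
      (HasCompactSupport.of_compactSpace _) (fun x => sub_nonneg.2 (hle x)) (x := x₀) ?_
    exact sub_ne_zero.2 (Ne.symm hx₀)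
  rw [integral_sub (integrable_const _) hΩi, integral_const, smul_eq_mul] at h1
  change 0 < D.volume * Λ - _ at h1
  have h2 : s * D.volume < 0 := by linarith
  exact neg_of_mul_neg_left h2 hV.le
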